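/- Let $p\ge 1$ be an integer and $K,\kappa>0$. Put $\theta_s=2\pi s/p$, $$u_\kappa(m)=\ln\Big[\frac1p\sum_{s=0}^{p-1}\cos(m\theta_s)\,e^{\kappa\cos\theta_s}\Big],\qquad \epsilon_m(\kappa)=\frac1p\sum_{l=0}^{p-1}u_\kappa(l)\cos(l\theta_m).$$ On a $D=4$ hypercubic lattice of size $N_1\times N_2\times N_3\times N_4$ (direction 4 is Euclidean time) let the link variables $\theta_{(r,\mu)}$ range over $\{2\pi s/p: s=0,\dots,p-1\}$, let $\Theta_{(r,\mu\nu)}=\theta_{(r,\mu)}+\theta_{(r+e_\mu,\nu)}-\theta_{(r+e_\nu,\mu)}-\theta_{(r,\nu)}$, and define $$\mathcal Z_{\sf sdG}(K,\kappa)=\sum_{\{\theta\}}\exp\Big[\sum_r K\big(\cos\Theta_{(r,12)}+\cos\Theta_{(r,23)}+\cos\Theta_{(r,31)}\big)\Big]\exp\Big[\sum_r\sum_{m=0}^{p-1}\epsilon_m(\kappa)\big(\cos m\Theta_{(r,41)}+\cos m\Theta_{(r,42)}+\cos m\Theta_{(r,43)}\big)\Big].$$ The first factor is the magnetic and the second the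 electric Boltzmann weight. The lattice is periodic in time. In each space direction the boundary condition is self-dual: $\theta_{(r,\mu)}=0$ whenever $r$ lies beyond the last site, while links at the first site are free. On the links of the $L_1\times L_2\times L_3$ space lattice (same spatial boundary condition) let $V,U$ be the $p\times p$ matrices $V|s\rangle=|s-1\rangle$, $U|s\rangle=e^{2\pi i s/p}|s\rangle$, let $V_{(r,\mu)},U_{(r,\mu)}$ be their copies on the link $(r,\mu)$, and for $\mu=1,2,3$ (mod 3) let $B_{(r,\mu)}=U_{(r,\mu+1)}U_{(r+e_{\mu+1},\mu+2)}U^\dagger_{(r+e_{\mu+2},\mu+1)}U^\dagger_{(r,\mu+2)}$, where operators beyond the boundary are $1$. Let $P_{\sf GI}$ be the orthogonal projector onto the gauge-invariant states, i.e. those fixed by $\prod_{\nu=1}^3V_{(r,\nu)}V^\dagger_{(r-e_\nu,\nu)}$ for every $r$. Let $$H_{\sf G}[\lambda]=\tfrac12\sum_{r,\nu}\big(V_{(r,\nu)}+\lambda B_{(r,\nu)}+{\rm h.c.}\big),\qquad T_{\sf sdG}(K,\kappa)=e^{\frac\kappa2\sum_{r,\mu}(V_{(r,\mu)}+V^\dagger_{(r,\mu)})}\,e^{\frac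 K2\sum_{r,\mu}(B_{(r,\mu)}+B^\dagger_{(r,\mu)})}.$$ Then the following hold. 1. The argument of the logarithm in $u_\kappa(m)$ is positive for all $m$, $e^{\frac\kappa2(V+V^\dagger)}=\sum_{m=0}^{p-1}e^{u_\kappa(m)}V^m$, and $u_\kappa(l)=\sum_{m=0}^{p-1}\epsilon_m(\kappa)\cos(l\theta_m)$ for all $l\in\mathbb N$. 2. (Quantum self-duality on gauge-invariant states.) For all $L_1,L_2,L_3\ge1$ there is an operator $\mathcal U$ with $\mathcal U^\dagger\mathcal U=\mathcal U\mathcal U^\dagger=P_{\sf GI}$ such that, with $\bar r$ the site obtained from $r$ by reversing all coordinates, $\mathcal U V_{(r,\mu)}=B_{(\bar r,\mu)}\,\mathcal U$ and $\mathcal U B_{(r,\mu)}=V_{(\bar r,\mu)}\,\mathcal U$ for all $r,\mu$. Moreover $\mathcal U H_{\sf G}[\lambda]=\lambda H_{\sf G}[1/\lambda]\,\mathcal U$ for all real $\lambda\neq0$. 3. For all $N_1,\dots,N_4\ge1$, $\ \mathcal Z_{\sf sdG}(K,\kappa)=p^{N_1N_2N_3N_4}\,{\rm Tr}\big[T_{\sf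 sdG}(K,\kappa)^{N_4}P_{\sf GI}\big]$ (with $L_i=N_i$), and the model is exactly self-dual under the exchange of its electric and magnetic Boltzmann weights: $$\mathcal Z_{\sf sdG}(K,\kappa)=\mathcal Z_{\sf sdG}(\kappa,K).$$ 4. If instead the lattice is periodic in all four directions, with partition function $\mathcal Z^{\rm per}_{\sf sdG}$, then $$\frac{\ln\mathcal Z^{\rm per}_{\sf sdG}(K,\kappa)-\ln\mathcal Z^{\rm per}_{\sf sdG}(\kappa,K)}{N_1N_2N_3N_4}\longrightarrow0\qquad\text{as all } N_i\to\infty.$$ -/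

import Mathlib

open scoped Matrix BigOperators

noncomputable section

namespace ZpGauge

/-! ### Finite hypercubic lattices -/

/-- Sites of an `N 0 × ⋯ × N (d-1)` hypercubic lattice. -/
abbrev Site {d : ℕ} (N : Fin d → ℕ) : Type := (i : Fin d) → Fin (N i)

/-- The site `r + e_μ`. The directions in `P` are periodic; in every other direction the lattice
ends, and `none` means that `r + e_μ` lies outside. -/
def forward {d : ℕ} {N : Fin d → ℕ} (P : Finset (Fin d)) (μ : Fin d) (r : Site N) :
    Option (Site N) :=
  if h : (r μ : ℕ) + 1 < N μ then some (Function.update r μ ⟨(r μ : ℕ) + 1, h⟩)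
  else if μ ∈ P then some (Function.update r μ ⟨0, (r μ).pos⟩)
  else none

/-- The site `r - e_μ` in a direction where the lattice is not periodic
(`none` if it lies outside). -/
def backward {d : ℕ} {N : Fin d → ℕ} (μ : Fin d) (r : Site N) : Option (Site N) :=
  if 0 < (r μ : ℕ) then
    some (Function.update r μ ⟨(r μ : ℕ) - 1, lt_of_le_of_lt (Nat.sub_le _ _) (r μ).isLt⟩)
  else none

/-- The site obtained from `r` by reversing every coordinate. -/
def reflect {d : ℕ} {N : Fin d → ℕ} (r : Site N) : Site N := fun i => (r i).rev

/-- The value of a field at a site that may lie outside the lattice, where fields are set to `0`. -/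
def atSite {d : ℕ} {N : Fin d → ℕ} (f : Site N → ℝ) (o : Option (Site N)) : ℝ := o.elim 0 f

/-- `Θ_{(r,μν)} = θ_{(r,μ)} + θ_{(r+e_μ,ν)} - θ_{(r+e_ν,μ)} - θ_{(r,ν)}`. -/
def plaquetteAngle {d : ℕ} {N : Fin d → ℕ} (P : Finset (Fin d)) (θ : Site N → Fin d → ℝ)
    (r : Site N) (μ ν : Fin d) : ℝ :=
  θ r μ + atSite (fun x => θ x ν) (forward P μ r)
    - atSite (fun x => θ x μ) (forward P ν r) - θ r ν

/-! ### The coefficients of the electric Boltzmann weight -/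

/-- `θ_s = 2πs/p`. -/
def angle (p s : ℕ) : ℝ := 2 * Real.pi * s / p

/-- `(1/p) ∑_s cos(m θ_s) exp(κ cos θ_s)`. -/
def dualWeight (p : ℕ) (κ : ℝ) (m : ℕ) : ℝ :=
  (1 / (p : ℝ)) * ∑ s ∈ Finset.range p, Real.cos (m * angle p s) *
    Real.exp (κ * Real.cos (angle p s))

/-- `u_κ(m) = ln [(1/p) ∑_s cos(m θ_s) exp(κ cos θ_s)]`. -/
def logDualWeight (p : ℕ) (κ : ℝ) (m : ℕ) : ℝ := Real.log (dualWeight p κ m)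

/-- `ε_m(κ)`, the coefficients of the discrete cosine series of `u_κ`. -/
def epsilonCoeff (p : ℕ) (κ : ℝ) (m : ℕ) : ℝ :=
  (1 / (p : ℝ)) * ∑ l ∈ Finset.range p, logDualWeight p κ l * Real.cos (l * angle p m)

/-! ### The classical `D = 4` model -/

/-- The partition function of the `ℤ_p` gauge model on an `N 0 × N 1 × N 2 × N 3` lattice which is
periodic in the directions in `P`. Direction `3` is the Euclidean time. The link variables
`θ_{(r,μ)} = 2π s_{(r,μ)}/p` vanish outside the lattice. -/
def partitionFunction (p : ℕ) [NeZero p] (N : Fin 4 → ℕ) (P : Finset (Fin 4)) (K κ : ℝ) : ℝ :=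
  ∑ s : Site N → Fin 4 → ZMod p,
    let Θ : Site N → Fin 4 → Fin 4 → ℝ := plaquetteAngle P (fun r μ => angle p (s r μ).val)
    Real.exp (∑ r, K * (Real.cos (Θ r 0 1) + Real.cos (Θ r 1 2) + Real.cos (Θ r 2 0))) *
    Real.exp (∑ r, ∑ m ∈ Finset.range p, epsilonCoeff p κ m *
      (Real.cos (m * Θ r 3 0) + Real.cos (m * Θ r 3 1) + Real.cos (m * Θ r 3 2)))

/-- Periodic in time and self-dual (free at one end, fixed to `0` at the other) in each of the
three space directions. -/
def Z_sdG (p : ℕ) [NeZero p] (N : Fin 4 → ℕ) (K κ : ℝ) : ℝ := partitionFunction p N {3} K κ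

/-- Periodic in all four directions. -/
def Z_sdG_periodic (p : ℕ) [NeZero p] (N : Fin 4 → ℕ) (K κ : ℝ) : ℝ :=
  partitionFunction p N Finset.univ K κ

/-! ### The quantum `p`-state gauge model in `d = 3` -/

/-- `V |s⟩ = |s - 1⟩`. -/
def weylV (p : ℕ) : Matrix (ZMod p) (ZMod p) ℂ := Matrix.of fun i j => if j = i + 1 then 1 else 0

/-- `U |s⟩ = ω ^ s |s⟩` with `ω = exp (2πi/p)`. -/
def weylU (p : ℕ) : Matrix (ZMod p) (ZMod p) ℂ :=
  Matrix.diagonal fun s => Complex.exp (2 * Real.pi * Complex.I / p) ^ s.val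

/-- Labels of the product basis of the state space: one element of `ℤ_p` on every link. -/
abbrev Conf (p : ℕ) (L : Fin 3 → ℕ) : Type := Site L × Fin 3 → ZMod p

variable {p : ℕ} [NeZero p] {L : Fin 3 → ℕ}

/-- The operator `A` acting on the tensor factor of the link `ℓ`. -/
def onLink (A : Matrix (ZMod p) (ZMod p) ℂ) (ℓ : Site L × Fin 3) :
    Matrix (Conf p L) (Conf p L) ℂ :=
  Matrix.of fun c c' => if ∀ k, k ≠ ℓ → c k = c' k then A (c ℓ) (c' ℓ) else 0

/-- The same for a link whose base point may lie outside the lattice; there it is `1`. -/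
def onLink? (A : Matrix (ZMod p) (ZMod p) ℂ) (o : Option (Site L)) (μ : Fin 3) :
    Matrix (Conf p L) (Conf p L) ℂ :=
  o.elim 1 fun r => onLink A (r, μ)

/-- `V_{(r,μ)}`. -/
def opV (r : Site L) (μ : Fin 3) : Matrix (Conf p L) (Conf p L) ℂ := onLink (weylV p) (r, μ)

/-- `B_{(r,μ)} = U_{(r,μ+1)} U_{(r+e_{μ+1},μ+2)} U†_{(r+e_{μ+2},μ+1)} U†_{(r,μ+2)}`, with
directions counted modulo `3`. -/
def opB (r : Site L) (μ : Fin 3) : Matrix (Conf p L) (Conf p L) ℂ :=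
  onLink (weylU p) (r, μ + 1) * onLink? (weylU p) (forward ∅ (μ + 1) r) (μ + 2) *
    (onLink? (weylU p) (forward ∅ (μ + 2) r) (μ + 1))ᴴ * (onLink (weylU p) (r, μ + 2))ᴴ

/-- The generator `∏_ν V_{(r,ν)} V†_{(r-e_ν,ν)}` of the gauge transformations at `r`. -/
def gaugeGen (r : Site L) : Matrix (Conf p L) (Conf p L) ℂ :=
  (opV r 0 * (onLink? (weylV p) (backward 0 r) 0)ᴴ) *
  (opV r 1 * (onLink? (weylV p) (backward 1 r) 1)ᴴ) *
  (opV r 2 * (onLink? (weylV p) (backward 2 r) 2)ᴴ)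

variable (p L)

/-- The gauge-invariant states. -/
def gaugeInvariant : Submodule ℂ (EuclideanSpace ℂ (Conf p L)) :=
  ⨅ r : Site L, LinearMap.ker (Matrix.toEuclideanLin (gaugeGen (p := p) r) - LinearMap.id)

/-- The orthogonal projector onto the gauge-invariant states. -/
def projGI : Matrix (Conf p L) (Conf p L) ℂ :=
  Matrix.toEuclideanLin.symm (gaugeInvariant p L).starProjection.toLinearMap

/-- The `p`-state gauge Hamiltonian `(1/2) ∑_r ∑_ν (V_{(r,ν)} + λ B_{(r,ν)} + h.c.)`. -/
def hamiltonian (lam : ℝ) : Matrix (Conf p L) (Conf p L) ℂ :=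
  (1 / 2 : ℂ) • ∑ r : Site L, ∑ μ : Fin 3,
    ((opV r μ + (lam : ℂ) • opB r μ) + (opV r μ + (lam : ℂ) • opB r μ)ᴴ)

/-- `T_sdG = exp((κ/2) ∑ (V + V†)) exp((K/2) ∑ (B + B†))`. -/
def transferMatrix (K κ : ℝ) : Matrix (Conf p L) (Conf p L) ℂ :=
  NormedSpace.exp (((κ / 2 : ℝ) : ℂ) • ∑ r : Site L, ∑ μ : Fin 3, (opV r μ + (opV r μ)ᴴ)) *
  NormedSpace.exp (((K / 2 : ℝ) : ℂ) • ∑ r : Site L, ∑ μ : Fin 3, (opB r μ + (opB r μ)ᴴ))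

end ZpGauge

end

noncomputable section

namespace ZpGauge

/-! ### Difference operators with zero boundary values -/

section Lattice

variable {d : ℕ} {N : Fin d → ℕ} {A : Type*} [AddCommGroup A]

/-! The self-dual boundary condition makes every forward difference injective, hence bijective on
`ZMod p`-valued fields. On the box the gradient is therefore injective and the kernel of the curl is
exactly its image (`grad_injective`, `exists_grad_eq`). Reflecting all coordinates transposes a
difference (`sum_mul_diff`), so `dualForm c c'`, which pairs a reflected field with the curl of
another, is antisymmetric, and its radical is the space of pure gauges. The Fourier kernel
`stdAddChar (dualForm c c')`, suitably normalised, is then Hermitian and squares to the projector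
`projGI`. Shifting one of its arguments on a single link multiplies it by the character of one curl,
so it exchanges link shifts `opV` with plaquette phases `opB` (`dualityOp_mul_opV`,
`dualityOp_mul_opB`). For the classical model, the temporal links at a given time act as a gauge
transformation between successive spatial slices. Summing over them inserts `gaugeSum` into the
transfer matrix, and periodic time produces a trace (`Z_sdG_eq_trace`). Intertwining with the
duality operator and cyclicity of the trace exchange the couplings
(`trace_transferMatrix_pow_swap`). Periodic and self-dual lattices have the same weights away from
the boundary sites, and at each of those the weight changes by a uniformly bounded factor. The free
energies thus differ by a surface term, negligible compared with the volume. -/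

lemma forward_empty_eq_some_iff {μ : Fin d} {r r' : Site N} :
    forward ∅ μ r = some r' ↔ (r' μ : ℕ) = r μ + 1 ∧ ∀ i, i ≠ μ → r' i = r i := by
  unfold forward
  constructor
  · intro h
    split_ifs at h with h1 h2
    · obtain rfl := Option.some.inj h
      refine ⟨by simp, fun i hi => by simp [hi]⟩
    · simp at h2
  · rintro ⟨h1, h2⟩
    have h3 : (r μ : ℕ) + 1 < N μ := h1 ▸ (r' μ).isLt
    rw [dif_pos h3]
    congr 1
    funext i
    by_cases hi : i = μ
    · subst hi
      exact Fin.ext (by simp [h1])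
    · simp [hi, h2 i hi]

lemma forward_empty_eq_none_iff {μ : Fin d} {r : Site N} :
    forward ∅ μ r = none ↔ (r μ : ℕ) + 1 = N μ := by
  unfold forward
  have := (r μ).isLt
  split_ifs with h1 h2
  · simp; omega
  · simp at h2
  · simp; omega

lemma backward_eq_some_iff {μ : Fin d} {r r' : Site N} :
    backward μ r = some r' ↔ forward ∅ μ r' = some r := by
  rw [forward_empty_eq_some_iff]
  unfold backward
  constructor
  · intro h
    split_ifs at h with h1
    obtain rfl := Option.some.inj h
    refine ⟨by simp; omega, fun i hi => by simp [hi]⟩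
  · rintro ⟨h1, h2⟩
    rw [if_pos (by omega)]
    congr 1
    funext i
    by_cases hi : i = μ
    · subst hi
      exact Fin.ext (by simp [h1])
    · simp [hi, h2 i hi]

@[simp] lemma reflect_reflect (r : Site N) : reflect (reflect r) = r := by
  funext i; simp [reflect]

/-- Reflection of all coordinates as a permutation of the sites. -/
def reflectEquiv : Site N ≃ Site N :=
  ⟨reflect, reflect, reflect_reflect, reflect_reflect⟩

@[simp] lemma reflectEquiv_apply (r : Site N) : reflectEquiv r = reflect r := rfl

/-- Reflection reverses the orientation of every bond; this is what transposes the hopping matrix.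
-/
lemma forward_reflect_iff {μ : Fin d} {r r' : Site N} :
    forward ∅ μ (reflect r') = some (reflect r) ↔ forward ∅ μ r = some r' := by
  simp only [forward_empty_eq_some_iff, reflect, Fin.val_rev]
  have := (r μ).isLt
  have := (r' μ).isLt
  refine and_congr (by omega) (forall_congr' fun i => imp_congr_right fun _ => ?_)
  rw [Fin.rev_inj, eq_comm]

/-- The field `r ↦ f (r + e_μ)`, extended by zero. -/
def hop (μ : Fin d) (f : Site N → A) (r : Site N) : A := (forward ∅ μ r).elim 0 f

lemma hop_eq_sum (μ : Fin d) (f : Site N → A) (r : Site N) :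
    hop μ f r = ∑ r', if forward ∅ μ r = some r' then f r' else 0 := by
  unfold hop
  cases h : forward ∅ μ r with
  | none => simp
  | some a => simp

/-- The forward difference `f (r + e_μ) - f r`. -/
def diff (μ : Fin d) : (Site N → A) →+ (Site N → A) where
  toFun f r := hop μ f r - f r
  map_zero' := by
    funext r; unfold hop; cases forward ∅ μ r <;> simp
  map_add' f g := by
    funext r
    have : hop μ (f + g) r = hop μ f r + hop μ g r := by
      unfold hop; cases forward ∅ μ r <;> simp
    simp only [this, Pi.add_apply]
    abel

lemma diff_apply (μ : Fin d) (f : Site N → A) (r : Site N) :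
    diff μ f r = hop μ f r - f r := rfl

lemma hop_hop (μ ν : Fin d) (f : Site N → A) (r : Site N) :
    hop μ (hop ν f) r = ∑ r', if (∃ a, forward ∅ μ r = some a ∧ forward ∅ ν a = some r')
      then f r' else 0 := by
  unfold hop
  cases h : forward ∅ μ r with
  | none => simp
  | some a =>
    simp only [Option.elim_some, Option.some.injEq, exists_eq_left']
    exact hop_eq_sum ν f a

lemma forward_forward_comm {μ ν : Fin d} {r r' : Site N}
    (h : ∃ a, forward ∅ μ r = some a ∧ forward ∅ ν a = some r') :
    ∃ a, forward ∅ ν r = some a ∧ forward ∅ μ a = some r' := by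
  by_cases hne : μ = ν
  · subst hne; exact h
  obtain ⟨a, h1, h2⟩ := h
  rw [forward_empty_eq_some_iff] at h1 h2
  refine ⟨Function.update r ν (r' ν), ?_, ?_⟩
  · rw [forward_empty_eq_some_iff]
    refine ⟨by simp [h2.1, h1.2 ν (Ne.symm hne)], fun i hi => by simp [hi]⟩
  · rw [forward_empty_eq_some_iff]
    refine ⟨by simp [hne, h2.2 μ hne, h1.1], fun i hi => ?_⟩
    by_cases hi' : i = ν
    · subst hi'; simp
    · simp [hi', h2.2 i hi', h1.2 i hi]

lemma hop_comm (μ ν : Fin d) (f : Site N → A) : hop μ (hop ν f) = hop ν (hop μ f) := by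
  funext r
  rw [hop_hop, hop_hop]
  refine Finset.sum_congr rfl fun r' _ => if_congr ⟨forward_forward_comm, forward_forward_comm⟩ rfl rfl

lemma hop_sub (μ : Fin d) (f g : Site N → A) : hop μ (f - g) = hop μ f - hop μ g := by
  funext r; simp only [hop, Pi.sub_apply]; cases forward ∅ μ r <;> simp

lemma diff_eq (μ : Fin d) (f : Site N → A) : diff μ f = hop μ f - f := rfl

lemma diff_comm (μ ν : Fin d) (f : Site N → A) : diff μ (diff ν f) = diff ν (diff μ f) := by
  simp only [diff_eq, hop_sub, hop_comm μ ν]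
  abel

lemma diff_injective (μ : Fin d) : Function.Injective (diff μ : (Site N → A) →+ _) := by
  rw [injective_iff_map_eq_zero]
  intro f hf
  -- `k` is the distance to the last site in direction `μ`. There the hopped term is `0`, so the
  -- difference is `-f`; vanishing then propagates backwards.
  have key : ∀ k : ℕ, ∀ r : Site N, (r μ : ℕ) + 1 + k = N μ → f r = 0 := by
    intro k
    induction k with
    | zero =>
      intro r hr
      have h := congrFun hf r
      rw [diff_apply, hop, forward_empty_eq_none_iff.2 (by simpa using hr)] at h
      simpa using h
    | succ k ih =>
      intro r hr
      have h := congrFun hf r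
      rw [diff_apply, hop] at h
      cases h' : forward ∅ μ r with
      | none => rw [forward_empty_eq_none_iff] at h'; omega
      | some a =>
        have ha := (forward_empty_eq_some_iff.1 h').1
        rw [h', Option.elim_some, ih a (by omega)] at h
        simpa using h
  funext r
  have := (r μ).isLt
  exact key (N μ - (r μ + 1)) r (by omega)

lemma diff_bijective [Finite A] (μ : Fin d) :
    Function.Bijective (diff μ : (Site N → A) →+ _) :=
  Finite.injective_iff_bijective.1 (diff_injective μ)

/-- Reflection turns the forward difference into its transpose. -/
lemma sum_mul_diff {R : Type*} [CommRing R] (μ : Fin d) (g f : Site N → R) :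
    ∑ r, g (reflect r) * diff μ f r = ∑ r, diff μ g (reflect r) * f r := by
  simp only [diff_apply, mul_sub, sub_mul, Finset.sum_sub_distrib, hop_eq_sum, Finset.mul_sum,
    Finset.sum_mul]
  congr 1
  rw [Finset.sum_comm]
  refine Finset.sum_congr rfl fun a _ => ?_
  refine Fintype.sum_equiv reflectEquiv _ _ fun b => ?_
  simp only [reflectEquiv_apply, forward_reflect_iff]
  split_ifs <;> simp

lemma hop_single (μ : Fin d) (r r' : Site N) (a : A) :
    hop μ (Pi.single r a) r' = (backward μ r).elim (0 : Site N → A) (fun b => Pi.single b a) r' := by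
  rw [hop_eq_sum]
  cases h : backward μ r with
  | none =>
    refine Finset.sum_eq_zero fun b _ => ?_
    rw [ite_eq_right_iff]
    intro hb
    rcases eq_or_ne b r with rfl | hne
    · rw [← backward_eq_some_iff, h] at hb; simp at hb
    · simp [hne]
  | some b =>
    simp only [Option.elim_some]
    rcases eq_or_ne r' b with rfl | hne
    · rw [backward_eq_some_iff] at h
      simp [h]
    · rw [Pi.single_eq_of_ne hne]
      refine Finset.sum_eq_zero fun c _ => ?_
      rw [ite_eq_right_iff]
      intro hb
      rcases eq_or_ne c r with rfl | hne'
      · rw [← backward_eq_some_iff, h] at hb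
        exact absurd (Option.some.inj hb).symm hne
      · simp [hne']

end Lattice

/-! ### Gradient and curl in three dimensions -/

section Curl

variable {L : Fin 3 → ℕ} {A : Type*} [AddCommGroup A]

/-- The lattice gradient. -/
def grad : (Site L → A) →+ (Site L × Fin 3 → A) where
  toFun f l := diff l.2 f l.1
  map_zero' := by funext l; simp
  map_add' f g := by funext l; simp

/-- The lattice curl. -/
def curl : (Site L × Fin 3 → A) →+ (Site L × Fin 3 → A) where
  toFun c l := diff (l.2 + 1) (fun r => c (r, l.2 + 2)) l.1 -
    diff (l.2 + 2) (fun r => c (r, l.2 + 1)) l.1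
  map_zero' := by
    funext l
    have : (fun _ : Site L => (0 : A)) = 0 := rfl
    simp [this]
  map_add' f g := by
    funext l
    have h : ∀ ν : Fin 3, (fun r => (f + g) (r, ν)) = (fun r => f (r, ν)) + fun r => g (r, ν) :=
      fun ν => rfl
    rw [h, h, map_add, map_add]
    simp only [Pi.add_apply]
    abel

lemma curl_apply (c : Site L × Fin 3 → A) (r : Site L) (μ : Fin 3) :
    curl c (r, μ) = diff (μ + 1) (fun r => c (r, μ + 2)) r -
      diff (μ + 2) (fun r => c (r, μ + 1)) r := rfl

lemma grad_apply (f : Site L → A) (r : Site L) (μ : Fin 3) : grad f (r, μ) = diff μ f r := rfl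

lemma curl_grad (f : Site L → A) : curl (grad f) = 0 := by
  funext l
  obtain ⟨r, μ⟩ := l
  rw [curl_apply]
  change diff (μ + 1) (diff (μ + 2) f) r - diff (μ + 2) (diff (μ + 1) f) r = 0
  rw [diff_comm, sub_self]

lemma grad_injective : Function.Injective (grad : (Site L → A) →+ _) := by
  intro f g h
  refine diff_injective (0 : Fin 3) ?_
  funext r
  exact congrFun h (r, 0)

/-- A potential is found by integrating the component in direction `0` alone. For the other
components, `diff 0` of the discrepancy vanishes because the curl does, and `diff 0` is injective.
-/
lemma exists_grad_eq [Finite A] {c : Site L × Fin 3 → A} (hc : curl c = 0) :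
    ∃ f, grad f = c := by
  obtain ⟨f, hf⟩ := (diff_bijective (N := L) (A := A) 0).2 fun r => c (r, 0)
  refine ⟨f, ?_⟩
  have h1 : ∀ μ, diff (μ + 1) (fun r => c (r, μ + 2)) = diff (μ + 2) (fun r => c (r, μ + 1)) :=
    fun μ => funext fun r => sub_eq_zero.1 (congrFun hc (r, μ))
  have key : ∀ μ, diff μ f = fun r => c (r, μ) := by
    intro μ
    refine diff_injective (0 : Fin 3) ?_
    rw [diff_comm, hf]
    fin_cases μ
    · rfl
    · exact (h1 2).symm
    · exact h1 1
  funext l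
  exact congrFun (key l.2) l.1

lemma grad_single (r : Site L) (a : A) :
    grad (Pi.single r a) = ∑ ν : Fin 3, ((backward ν r).elim 0 (fun b => Pi.single (b, ν) a)
      - Pi.single (r, ν) a) := by
  funext l
  obtain ⟨r', μ⟩ := l
  rw [grad_apply, diff_apply, hop_single, Finset.sum_apply, Finset.sum_eq_single μ]
  · rw [Pi.sub_apply]
    congr 1
    · cases backward μ r with
      | none => rfl
      | some b => simp [Pi.single_apply, Prod.ext_iff]
    · simp [Pi.single_apply, Prod.ext_iff]
  · intro ν _ hν
    rw [Pi.sub_apply, Pi.single_eq_of_ne (by simp [hν.symm]), sub_zero]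
    cases backward ν r with
    | none => rfl
    | some b => exact Pi.single_eq_of_ne (by simp [hν.symm]) _
  · simp

/-- The bilinear form `∑ c(r̄, μ) (curl c')(r, μ)`. -/
def dualForm {R : Type*} [CommRing R] (c c' : Site L × Fin 3 → R) : R :=
  ∑ r, ∑ μ, c (reflect r, μ) * curl c' (r, μ)

/-- Each difference is symmetric for the reflected pairing (`h2`), while the curl is antisymmetric
in its component indices, as the Levi-Civita symbol is. -/
lemma dualForm_antisymm {R : Type*} [CommRing R] (c c' : Site L × Fin 3 → R) :
    dualForm c c' = - dualForm c' c := by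
  have h : ∀ a b : Site L × Fin 3 → R, dualForm a b =
      ∑ μ : Fin 3, (∑ r, a (reflect r, μ) * diff (μ + 1) (fun r => b (r, μ + 2)) r -
        ∑ r, a (reflect r, μ) * diff (μ + 2) (fun r => b (r, μ + 1)) r) := by
    intro a b
    rw [dualForm, Finset.sum_comm]
    simp only [curl_apply, mul_sub, Finset.sum_sub_distrib]
  have h2 : ∀ (a b : Site L × Fin 3 → R) (μ ν lam : Fin 3),
      ∑ r, a (reflect r, μ) * diff lam (fun r => b (r, ν)) r =
      ∑ r, b (reflect r, ν) * diff lam (fun r => a (r, μ)) r := by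
    intro a b μ ν lam
    rw [sum_mul_diff lam (fun r => a (r, μ))]
    refine Fintype.sum_equiv reflectEquiv _ _ fun r => ?_
    simp [mul_comm]
  rw [h c c', h c' c]
  simp only [h2 c' c, Fin.sum_univ_three]
  simp only [show (0:Fin 3) + 1 = 1 from rfl, show (0:Fin 3) + 2 = 2 from rfl,
    show (1:Fin 3) + 1 = 2 from rfl, show (1:Fin 3) + 2 = 0 from rfl,
    show (2:Fin 3) + 1 = 0 from rfl, show (2:Fin 3) + 2 = 1 from rfl]
  ring

lemma dualForm_add_left {R : Type*} [CommRing R] (a b c : Site L × Fin 3 → R) :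
    dualForm (a + b) c = dualForm a c + dualForm b c := by
  simp [dualForm, add_mul, Finset.sum_add_distrib]

lemma dualForm_neg_left {R : Type*} [CommRing R] (a c : Site L × Fin 3 → R) :
    dualForm (-a) c = -dualForm a c := by
  simp [dualForm]

lemma dualForm_single_left {R : Type*} [CommRing R] (r : Site L) (μ : Fin 3) (c : Site L × Fin 3 → R) :
    dualForm (Pi.single (reflect r, μ) 1) c = curl c (r, μ) := by
  have : ∀ a b : Site L, reflect a = reflect b ↔ a = b := fun a b => reflectEquiv.apply_eq_iff_eq
  simp [dualForm, Pi.single_apply, Prod.ext_iff, this, ite_and]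

end Curl

/-! ### Characters of `ℤ_p` -/

section Characters

variable {p : ℕ} [NeZero p]

open ZMod (stdAddChar)

lemma re_stdAddChar_intCast (x : ℤ) :
    (stdAddChar (x : ZMod p)).re = Real.cos (2 * Real.pi * x / p) := by
  rw [ZMod.stdAddChar_coe, show 2 * (Real.pi : ℂ) * Complex.I * x / p =
    ((2 * Real.pi * x / p : ℝ) : ℂ) * Complex.I by push_cast; ring, Complex.exp_ofReal_mul_I_re]

lemma cos_mul_angle (m s : ℕ) :
    Real.cos (m * angle p s) = (stdAddChar ((m : ZMod p) * (s : ZMod p))).re := by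
  have := re_stdAddChar_intCast (p := p) (m * s)
  push_cast at this
  rw [this, angle]
  congr 1
  ring

lemma cos_angle_val (z : ZMod p) : Real.cos (angle p z.val) = (stdAddChar z).re := by
  simpa using cos_mul_angle (p := p) 1 z.val

lemma conj_stdAddChar (z : ZMod p) : (starRingEnd ℂ) (stdAddChar z) = stdAddChar (-z) :=
  (AddChar.map_neg_eq_conj _ _).symm

lemma stdAddChar_add_neg (z : ZMod p) :
    (stdAddChar z : ℂ) + stdAddChar (-z) = ((2 * Real.cos (angle p z.val) : ℝ) : ℂ) := by
  rw [cos_angle_val, ← conj_stdAddChar, Complex.add_conj]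

lemma sum_range_eq_sum_zmod {M : Type*} [AddCommMonoid M] (f : ℕ → M) :
    ∑ s ∈ Finset.range p, f s = ∑ k : ZMod p, f k.val := by
  refine Finset.sum_nbij' (fun s => (s : ZMod p)) ZMod.val ?_ ?_ ?_ ?_ ?_
  · simp
  · intro a _; simpa using ZMod.val_lt a
  · intro a ha; exact ZMod.val_cast_of_lt (by simpa using ha)
  · intro a _; simp
  · intro a ha; rw [ZMod.val_cast_of_lt (by simpa using ha)]

/-- The electric Boltzmann weight as a function on `ℤ_p`. -/
def weight (p : ℕ) (κ : ℝ) (z : ZMod p) : ℝ := dualWeight p κ z.val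

/-- The exponential weight is even in `k`, so the sine part of the character cancels between `k` and
`-k`. -/
lemma dualWeight_eq (κ : ℝ) (m : ℕ) : ((dualWeight p κ m : ℝ) : ℂ) =
    (p : ℂ)⁻¹ * ∑ k : ZMod p, stdAddChar ((m : ZMod p) * k) *
      Complex.exp (((κ * Real.cos (angle p k.val) : ℝ) : ℂ)) := by
  set w : ZMod p → ℂ := fun k => Complex.exp (((κ * Real.cos (angle p k.val) : ℝ) : ℂ)) with hw
  have hneg : ∀ k, w (-k) = w k := by
    intro k
    simp only [hw, cos_angle_val, ← conj_stdAddChar, Complex.conj_re]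
  have h1 : ∑ k : ZMod p, stdAddChar ((m : ZMod p) * k) * w k =
      ∑ k : ZMod p, stdAddChar (-((m : ZMod p) * k)) * w k := by
    refine Fintype.sum_equiv (Equiv.neg _) _ _ fun k => ?_
    simp [hneg]
  have h2 : ∑ k : ZMod p, stdAddChar ((m : ZMod p) * k) * w k =
      ∑ k : ZMod p, ((stdAddChar ((m : ZMod p) * k)).re : ℂ) * w k := by
    have h3 : 2 * ∑ k : ZMod p, stdAddChar ((m : ZMod p) * k) * w k =
        2 * ∑ k : ZMod p, ((stdAddChar ((m : ZMod p) * k)).re : ℂ) * w k := by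
      rw [two_mul]
      nth_rw 2 [h1]
      rw [← Finset.sum_add_distrib, Finset.mul_sum]
      refine Finset.sum_congr rfl fun k _ => ?_
      rw [← add_mul, stdAddChar_add_neg, cos_angle_val]
      push_cast; ring
    exact mul_left_cancel₀ two_ne_zero h3
  rw [h2, dualWeight, sum_range_eq_sum_zmod]
  simp only [cos_mul_angle, hw]
  push_cast
  simp

/-- Periodicity modulo `p`, which extends the cosine series from residues to all natural numbers. -/
lemma dualWeight_val_natCast (κ : ℝ) (m : ℕ) :
    dualWeight p κ (m : ZMod p).val = dualWeight p κ m := by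
  have h := dualWeight_eq (p := p) κ (m : ZMod p).val
  rw [ZMod.natCast_zmod_val, ← dualWeight_eq] at h
  exact_mod_cast h

lemma weight_eq (κ : ℝ) (z : ZMod p) : ((weight p κ z : ℝ) : ℂ) =
    (p : ℂ)⁻¹ * ∑ k : ZMod p, stdAddChar (z * k) *
      Complex.exp (((κ * Real.cos (angle p k.val) : ℝ) : ℂ)) := by
  rw [weight, dualWeight_eq, ZMod.natCast_zmod_val]

lemma weight_neg (κ : ℝ) (z : ZMod p) : weight p κ (-z) = weight p κ z := by
  have : ((weight p κ (-z) : ℝ) : ℂ) = (weight p κ z : ℝ) := by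
    rw [weight_eq, weight_eq]
    congr 1
    refine Fintype.sum_equiv (Equiv.neg _) _ _ fun k => ?_
    simp only [Equiv.neg_apply, neg_mul, mul_neg, cos_angle_val, ← conj_stdAddChar,
      Complex.conj_re]
  exact_mod_cast this

end Characters

/-! ### Translation operators -/

section Translations

variable {p : ℕ} [NeZero p] {G : Type*} [AddCommGroup G] [Fintype G] [DecidableEq G]

open ZMod (stdAddChar)

/-- The operator `(T_g ψ)(c) = ψ(c + g)`. -/
def transl (g : G) : Matrix G G ℂ := Matrix.of fun c c' => if c' = c + g then 1 else 0

omit [Fintype G] in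
lemma transl_apply (g c c' : G) : transl g c c' = if c' = c + g then 1 else 0 := rfl

lemma transl_mul_apply (g : G) (A : Matrix G G ℂ) (c c' : G) :
    (transl g * A) c c' = A (c + g) c' := by
  simp [Matrix.mul_apply, transl_apply]

lemma mul_transl_apply (g : G) (A : Matrix G G ℂ) (c c' : G) :
    (A * transl g) c c' = A c (c' - g) := by
  simp [Matrix.mul_apply, transl_apply, ← sub_eq_iff_eq_add]

lemma transl_mulVec (g : G) (v : G → ℂ) (c : G) : (transl g *ᵥ v) c = v (c + g) := by
  simp [Matrix.mulVec, dotProduct, transl_apply]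

omit [Fintype G] in
lemma transl_zero : transl (0 : G) = 1 := by
  ext c c'; simp [transl_apply, Matrix.one_apply, eq_comm]

lemma transl_mul (g h : G) : transl g * transl h = transl (g + h) := by
  ext c c'; rw [transl_mul_apply, transl_apply, transl_apply, add_assoc]

lemma transl_pow (g : G) (n : ℕ) : transl g ^ n = transl (n • g) := by
  induction n with
  | zero => simp [transl_zero]
  | succ n ih => rw [pow_succ, ih, transl_mul, succ_nsmul]

omit [Fintype G] in
lemma conjTranspose_transl (g : G) : (transl g)ᴴ = transl (-g) := by
  ext c c'
  rw [Matrix.conjTranspose_apply, transl_apply, transl_apply]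
  have : c = c' + g ↔ c' = c + -g := by rw [← sub_eq_add_neg, eq_sub_iff_add_eq, eq_comm]
  simp only [this]
  split_ifs <;> simp

lemma sum_stdAddChar_pairing (β : G →+ G →+ ZMod p) (hβ : ∀ x, β x = 0 → x = 0) (x : G) :
    ∑ y, (stdAddChar (β x y) : ℂ) = if x = 0 then (Fintype.card G : ℂ) else 0 := by
  classical
  have h := AddChar.sum_eq_ite ((stdAddChar (N := p)).compAddMonoidHom (β x))
  simp only [AddChar.compAddMonoidHom_apply] at h
  rw [h]
  refine if_congr ⟨fun h0 => hβ x ?_, ?_⟩ rfl rfl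
  · ext y
    have := DFunLike.congr_fun h0 y
    simp only [AddChar.compAddMonoidHom_apply, AddChar.zero_apply] at this
    exact ZMod.injective_stdAddChar (by simpa using this)
  · rintro rfl
    ext y
    simp

/-- The exponential of a sum of translations, by Fourier transform. -/
lemma exp_sum_transl (β : G →+ G →+ ZMod p) (hβ : ∀ x, β x = 0 → x = 0)
    {ι : Type*} [Fintype ι] (g : ι → G) (a : ℝ) (c c' : G) :
    NormedSpace.exp (((a / 2 : ℝ) : ℂ) • ∑ i, (transl (g i) + (transl (g i))ᴴ)) c c' =
      (Fintype.card G : ℂ)⁻¹ * ∑ k, stdAddChar (β (c - c') k) *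
        Complex.exp ((a * ∑ i, Real.cos (angle p (β (g i) k).val) : ℝ) : ℂ) := by
  set X : Matrix G G ℂ := ((a / 2 : ℝ) : ℂ) • ∑ i, (transl (g i) + (transl (g i))ᴴ) with hX
  -- The columns of this character table are common eigenvectors of all translations; nondegeneracy
  -- of `β` makes it unitary up to the factor `Fintype.card G`.
  set F : Matrix G G ℂ := Matrix.of fun c k => stdAddChar (β c k) with hF
  set v : G → ℂ := fun k => ((a * ∑ i, Real.cos (angle p (β (g i) k).val) : ℝ) : ℂ) with hv
  have hT : ∀ h, transl h * F = F * Matrix.diagonal fun k => stdAddChar (β h k) := by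
    intro h
    ext c k
    rw [transl_mul_apply, Matrix.mul_diagonal]
    simp [hF, AddChar.map_add_eq_mul]
  have hXF : X * F = F * Matrix.diagonal v := by
    have : Matrix.diagonal v = ((a / 2 : ℝ) : ℂ) • ∑ i,
        ((Matrix.diagonal fun k => stdAddChar (β (g i) k)) +
          Matrix.diagonal fun k => stdAddChar (β (-g i) k)) := by
      ext k k'
      rcases eq_or_ne k k' with rfl | hne
      · simp only [Matrix.diagonal_apply_eq, hv, Matrix.smul_apply, Matrix.sum_apply,
          Matrix.add_apply, map_neg, AddMonoidHom.neg_apply, stdAddChar_add_neg, smul_eq_mul]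
        push_cast
        rw [← Finset.mul_sum]
        ring
      · simp [Matrix.diagonal_apply_ne _ hne, Matrix.sum_apply]
    rw [this, hX, Matrix.smul_mul, Matrix.mul_smul, Matrix.sum_mul, Matrix.mul_sum]
    simp only [conjTranspose_transl, add_mul, mul_add, hT]
  have hFF : F * Fᴴ = (Fintype.card G : ℂ) • 1 := by
    ext c c'
    simp only [hF, Matrix.mul_apply, Matrix.conjTranspose_apply, Matrix.of_apply, Matrix.smul_apply,
      Matrix.one_apply, smul_eq_mul, mul_ite, mul_one, mul_zero]
    have h := sum_stdAddChar_pairing β hβ (c - c')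
    simp only [sub_eq_zero] at h
    rw [← h]
    refine Finset.sum_congr rfl fun k _ => ?_
    rw [map_sub, AddMonoidHom.sub_apply, sub_eq_add_neg, AddChar.map_add_eq_mul,
      ← conj_stdAddChar]
    rfl
  have hexp : NormedSpace.exp X * F = F * Matrix.diagonal (NormedSpace.exp v) := by
    rw [← Matrix.exp_diagonal]
    open scoped Matrix.Norms.Operator in
    exact (SemiconjBy.exp_right (show SemiconjBy F (Matrix.diagonal v) X from hXF.symm)).symm
  have hcard : (Fintype.card G : ℂ) ≠ 0 := Nat.cast_ne_zero.2 Fintype.card_ne_zero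
  have hfin : NormedSpace.exp X =
      (Fintype.card G : ℂ)⁻¹ • (F * Matrix.diagonal (NormedSpace.exp v) * Fᴴ) := by
    rw [← hexp, mul_assoc, hFF, Matrix.mul_smul, mul_one, smul_smul, inv_mul_cancel₀ hcard,
      one_smul]
  rw [hfin, Matrix.smul_apply, smul_eq_mul, Matrix.mul_apply]
  congr 1
  refine Finset.sum_congr rfl fun k _ => ?_
  rw [Matrix.mul_diagonal, Matrix.conjTranspose_apply, Pi.coe_exp, ← Complex.exp_eq_exp_ℂ,
    map_sub, AddMonoidHom.sub_apply, sub_eq_add_neg, AddChar.map_add_eq_mul, ← conj_stdAddChar]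
  simp only [hF, Matrix.of_apply, RCLike.star_def]
  ring

end Translations

/-! ### The electric Boltzmann weight -/

section Weight

variable {p : ℕ} [NeZero p]

open ZMod (stdAddChar)

omit [NeZero p] in
lemma mul_pairing_nondegenerate (x : ZMod p) (h : (AddMonoidHom.mul : ZMod p →+ ZMod p →+ ZMod p) x = 0) :
    x = 0 := by
  simpa using DFunLike.congr_fun h 1

lemma sum_stdAddChar_mul (x : ZMod p) :
    ∑ y, (stdAddChar (x * y) : ℂ) = if x = 0 then (p : ℂ) else 0 := by
  simpa [ZMod.card] using sum_stdAddChar_pairing AddMonoidHom.mul mul_pairing_nondegenerate x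

lemma sum_re_stdAddChar_mul (x : ZMod p) :
    ∑ y, (stdAddChar (x * y) : ℂ).re = if x = 0 then (p : ℝ) else 0 := by
  rw [← Complex.re_sum, sum_stdAddChar_mul]
  split_ifs <;> simp

/-! ### Positivity of the electric weight through a random walk. -/

lemma re_stdAddChar_mul_re (x y : ZMod p) :
    (stdAddChar x : ℂ).re * (stdAddChar y : ℂ).re =
      ((stdAddChar (x + y) : ℂ).re + (stdAddChar (x - y) : ℂ).re) / 2 := by
  rw [sub_eq_add_neg, AddChar.map_add_eq_mul, AddChar.map_add_eq_mul, ← conj_stdAddChar,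
    Complex.mul_re, Complex.mul_re, Complex.conj_re, Complex.conj_im]
  ring

/-- The cosine coefficients of `cos ^ n`, that is, the probability that the simple random walk on
the cycle of length `p` is at `z` after `n` steps. -/
def walkProb (n : ℕ) (z : ZMod p) : ℝ :=
  (1 / (p : ℝ)) * ∑ k : ZMod p, (stdAddChar (z * k) : ℂ).re * (stdAddChar k : ℂ).re ^ n

lemma walkProb_zero (z : ZMod p) : walkProb 0 z = if z = 0 then 1 else 0 := by
  have : (p : ℝ) ≠ 0 := NeZero.ne _
  simp only [walkProb, pow_zero, mul_one, sum_re_stdAddChar_mul]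
  split_ifs <;> simp [this]

lemma walkProb_succ (n : ℕ) (z : ZMod p) :
    walkProb (n + 1) z = (walkProb n (z + 1) + walkProb n (z - 1)) / 2 := by
  simp only [walkProb]
  rw [← mul_add, ← Finset.sum_add_distrib, mul_div_assoc, Finset.sum_div]
  congr 1
  refine Finset.sum_congr rfl fun k _ => ?_
  rw [pow_succ', ← mul_assoc, re_stdAddChar_mul_re, add_mul z 1 k, sub_mul z 1 k, one_mul]
  ring

lemma walkProb_nonneg (n : ℕ) (z : ZMod p) : 0 ≤ walkProb n z := by
  induction n generalizing z with
  | zero => rw [walkProb_zero]; split_ifs <;> norm_num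
  | succ n ih => rw [walkProb_succ]; linarith [ih (z + 1), ih (z - 1)]

/-- The walk that steps by `+1` every time reaches `n` after `n` steps. -/
lemma walkProb_natCast_pos (n : ℕ) : 0 < walkProb n (n : ZMod p) := by
  induction n with
  | zero => rw [walkProb_zero]; simp
  | succ n ih =>
    rw [walkProb_succ]
    have h : ((n + 1 : ℕ) : ZMod p) - 1 = n := by push_cast; ring
    rw [h]
    linarith [walkProb_nonneg n (((n + 1 : ℕ) : ZMod p) + 1)]

/-- Expanding the exponential writes the weight as a series of walk probabilities with positive
coefficients. All terms are nonnegative, and the term of index `m` is positive. -/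
lemma dualWeight_pos {κ : ℝ} (hκ : 0 < κ) (m : ℕ) : 0 < dualWeight p κ m := by
  have h : HasSum (fun n : ℕ => κ ^ n / n.factorial * walkProb n (m : ZMod p))
      (dualWeight p κ m) := by
    have h1 : ∀ k : ZMod p, HasSum (fun n : ℕ => (stdAddChar ((m : ZMod p) * k) : ℂ).re *
        ((κ * (stdAddChar k : ℂ).re) ^ n / n.factorial))
        ((stdAddChar ((m : ZMod p) * k) : ℂ).re * Real.exp (κ * (stdAddChar k : ℂ).re)) := by
      intro k
      refine HasSum.mul_left _ ?_
      rw [Real.exp_eq_exp_ℝ]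
      exact NormedSpace.expSeries_div_hasSum_exp (κ * (stdAddChar k : ℂ).re)
    have h2 := (hasSum_sum (s := Finset.univ) fun k _ => h1 k).mul_left (1 / (p : ℝ))
    convert! h2 using 1
    · funext n
      rw [walkProb, Finset.mul_sum, Finset.mul_sum, Finset.mul_sum]
      refine Finset.sum_congr rfl fun k _ => ?_
      rw [mul_pow]; ring
    · rw [dualWeight, sum_range_eq_sum_zmod]
      simp [cos_mul_angle, cos_angle_val]
  have hpos : ∀ n : ℕ, 0 < κ ^ n / n.factorial := fun n => by positivity
  calc 0 < κ ^ m / m.factorial * walkProb m (m : ZMod p) :=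
        mul_pos (hpos m) (walkProb_natCast_pos m)
    _ ≤ dualWeight p κ m := le_hasSum h m fun n _ => mul_nonneg (hpos n).le (walkProb_nonneg n _)

lemma weight_pos {κ : ℝ} (hκ : 0 < κ) (z : ZMod p) : 0 < weight p κ z := dualWeight_pos hκ _

lemma exp_logDualWeight {κ : ℝ} (hκ : 0 < κ) (m : ℕ) :
    Real.exp (logDualWeight p κ m) = dualWeight p κ m := Real.exp_log (dualWeight_pos hκ m)

omit [NeZero p] in
lemma weylV_eq : weylV p = transl (1 : ZMod p) := rfl

lemma exp_weylV {κ : ℝ} (hκ : 0 < κ) :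
    NormedSpace.exp (((κ / 2 : ℝ) : ℂ) • (weylV p + (weylV p)ᴴ)) =
      ∑ m ∈ Finset.range p, ((Real.exp (logDualWeight p κ m) : ℝ) : ℂ) • weylV p ^ m := by
  ext c c'
  have h := exp_sum_transl AddMonoidHom.mul mul_pairing_nondegenerate
    (fun _ : Unit => (1 : ZMod p)) κ c c'
  simp only [Finset.univ_unique, Finset.sum_singleton, AddMonoidHom.mul_apply, one_mul, ZMod.card]
    at h
  rw [weylV_eq, h, ← weight_eq, sum_range_eq_sum_zmod, Matrix.sum_apply, ← neg_sub c' c, weight_neg]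
  simp only [exp_logDualWeight hκ, transl_pow, Matrix.smul_apply, transl_apply, nsmul_eq_mul,
    ZMod.natCast_zmod_val, mul_one, smul_eq_mul, mul_ite, mul_zero]
  simp only [← sub_eq_iff_eq_add', Finset.sum_ite_eq, Finset.mem_univ, if_true, weight]

/-- Orthogonality of characters inverts the cosine transform up to symmetrisation: it returns the
mean of the values at `l` and `-l`, which agree because the weight is even. -/
lemma logDualWeight_eq_sum (κ : ℝ) (l : ℕ) : logDualWeight p κ l =
    ∑ m ∈ Finset.range p, epsilonCoeff p κ m * Real.cos (l * angle p m) := by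
  have hp : (p : ℝ) ≠ 0 := NeZero.ne _
  set u : ZMod p → ℝ := fun z => Real.log (weight p κ z) with hu
  have h1 : ∀ m : ZMod p, epsilonCoeff p κ m.val * Real.cos (l * angle p m.val) =
      ∑ j : ZMod p, (1 / (p : ℝ)) * u j *
        (((stdAddChar ((j + (l : ZMod p)) * m) : ℂ).re + (stdAddChar ((j - (l : ZMod p)) * m) : ℂ).re) / 2) := by
    intro m
    rw [epsilonCoeff, sum_range_eq_sum_zmod, Finset.mul_sum, Finset.sum_mul]
    refine Finset.sum_congr rfl fun j _ => ?_
    simp only [cos_mul_angle, ZMod.natCast_zmod_val]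
    rw [add_mul, sub_mul, ← re_stdAddChar_mul_re, hu]
    simp only [logDualWeight, weight]
    ring
  rw [sum_range_eq_sum_zmod]
  simp only [h1]
  rw [Finset.sum_comm]
  simp only [← Finset.mul_sum, ← Finset.sum_div, Finset.sum_add_distrib, sum_re_stdAddChar_mul]
  have h2 : ∀ j : ZMod p, 1 / (p : ℝ) * u j * (((if j + (l : ZMod p) = 0 then (p : ℝ) else 0) +
      if j - (l : ZMod p) = 0 then (p : ℝ) else 0) / 2) =
      (if j = -(l : ZMod p) then u j / 2 else 0) + if j = (l : ZMod p) then u j / 2 else 0 := by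
    intro j
    simp only [add_eq_zero_iff_eq_neg, sub_eq_zero]
    split_ifs <;> field_simp <;> ring
  simp only [h2, Finset.sum_add_distrib, Finset.sum_ite_eq', Finset.mem_univ, if_true]
  have h3 : u (-(l : ZMod p)) = u l := by simp only [hu, weight_neg]
  have h4 : u l = logDualWeight p κ l := by
    simp only [hu, weight, dualWeight_val_natCast, logDualWeight]
  rw [h3, h4, add_halves]

end Weight

/-! ### The operators of the quantum model -/

section Quantum

variable {p : ℕ} [NeZero p] {L : Fin 3 → ℕ}

open ZMod (stdAddChar)

lemma weylU_eq : weylU p = Matrix.diagonal fun s => stdAddChar s := by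
  unfold weylU
  congr 1
  funext s
  have h := ZMod.stdAddChar_coe (N := p) s.val
  rw [Int.cast_natCast, ZMod.natCast_zmod_val] at h
  rw [h, ← Complex.exp_nat_mul]
  congr 1
  push_cast
  ring

omit [NeZero p] in
lemma onLink_diagonal (f : ZMod p → ℂ) (l : Site L × Fin 3) :
    onLink (Matrix.diagonal f) l = Matrix.diagonal fun c : Conf p L => f (c l) := by
  ext c c'
  rcases eq_or_ne c c' with rfl | hne
  · simp [onLink]
  · rw [Matrix.diagonal_apply_ne _ hne, onLink, Matrix.of_apply]
    split_ifs with h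
    · refine Matrix.diagonal_apply_ne _ fun hl => hne (funext fun k => ?_)
      rcases eq_or_ne k l with rfl | hk
      · exact hl
      · exact h k hk
    · rfl

lemma onLink?_weylU (o : Option (Site L)) (μ : Fin 3) :
    onLink? (weylU p) o μ =
      Matrix.diagonal fun c : Conf p L => stdAddChar (o.elim 0 fun r => c (r, μ)) := by
  cases o with
  | none => simp [onLink?]
  | some r => rw [onLink?, Option.elim_some, weylU_eq, onLink_diagonal]; rfl

lemma opB_eq (r : Site L) (μ : Fin 3) : opB r μ =
    Matrix.diagonal fun c : Conf p L => stdAddChar (curl c (r, μ)) := by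
  rw [opB, onLink?_weylU, onLink?_weylU, weylU_eq, onLink_diagonal, onLink_diagonal]
  simp only [Matrix.diagonal_conjTranspose, Matrix.diagonal_mul_diagonal]
  congr 1
  funext c
  simp only [Pi.star_apply, RCLike.star_def, conj_stdAddChar, ← AddChar.map_add_eq_mul]
  congr 1
  rw [curl_apply, diff_apply, diff_apply, hop, hop]
  abel

omit [NeZero p] in
lemma onLink_weylV (l : Site L × Fin 3) :
    onLink (weylV p) l = transl (Pi.single l 1 : Conf p L) := by
  ext c c'
  rw [onLink, Matrix.of_apply, weylV_eq, transl_apply, transl_apply, ← ite_and]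
  refine if_congr ⟨fun ⟨h1, h2⟩ => funext fun k => ?_, ?_⟩ rfl rfl
  · rcases eq_or_ne k l with rfl | hk
    · simp [h2]
    · simp [h1 k hk, hk]
  · rintro rfl
    refine ⟨fun k hk => by simp [hk], by simp⟩

omit [NeZero p] in
lemma opV_eq (r : Site L) (μ : Fin 3) :
    opV r μ = transl (Pi.single (r, μ) 1 : Conf p L) := onLink_weylV _

omit [NeZero p] in
lemma onLink?_weylV (o : Option (Site L)) (μ : Fin 3) :
    onLink? (weylV p) o μ =
      transl (o.elim 0 (fun b => Pi.single (b, μ) 1) : Conf p L) := by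
  cases o with
  | none => simp [onLink?, transl_zero]
  | some r => exact onLink_weylV _

lemma gaugeGen_eq (r : Site L) :
    gaugeGen r = transl (-grad (Pi.single r 1) : Conf p L) := by
  rw [gaugeGen]
  simp only [opV_eq, onLink?_weylV, conjTranspose_transl, transl_mul]
  congr 1
  rw [grad_single, Fin.sum_univ_three]
  abel

/-! ### The projector onto the gauge-invariant states -/

variable (p L) in
/-- The sum over all gauge transformations. -/
def gaugeSum : Matrix (Conf p L) (Conf p L) ℂ := ∑ f : Site L → ZMod p, transl (grad f)

/-- Two configurations with the same curl differ by a gradient, and by only one since `grad` is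
injective; hence the entry is exactly `1`. -/
lemma gaugeSum_apply (c c' : Conf p L) :
    gaugeSum p L c c' = if curl (c' - c) = 0 then 1 else 0 := by
  simp only [gaugeSum, Matrix.sum_apply, transl_apply]
  split_ifs with h
  · obtain ⟨f, hf⟩ := exists_grad_eq h
    rw [Finset.sum_eq_single f]
    · simp [hf]
    · intro g _ hg
      rw [if_neg]
      intro h'
      exact hg (grad_injective (by rw [hf, h', add_sub_cancel_left]))
    · simp
  · refine Finset.sum_eq_zero fun f _ => ?_
    rw [if_neg]
    rintro rfl
    exact h (by rw [add_sub_cancel_left, curl_grad])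

lemma conjTranspose_gaugeSum : (gaugeSum p L)ᴴ = gaugeSum p L := by
  rw [gaugeSum, Matrix.conjTranspose_sum]
  refine Fintype.sum_equiv (Equiv.neg _) _ _ fun f => ?_
  rw [conjTranspose_transl, Equiv.neg_apply, map_neg]

lemma mem_gaugeInvariant_iff (v : EuclideanSpace ℂ (Conf p L)) :
    v ∈ gaugeInvariant p L ↔ ∀ (f : Site L → ZMod p) c, v (c + grad f) = v c := by
  have h : v ∈ gaugeInvariant p L ↔ ∀ (r : Site L) c, v (c + -grad (Pi.single r 1)) = v c := by
    rw [gaugeInvariant, Submodule.mem_iInf]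
    refine forall_congr' fun r => ?_
    rw [LinearMap.mem_ker, LinearMap.sub_apply, LinearMap.id_apply, sub_eq_zero,
      Matrix.toLpLin_apply, gaugeGen_eq]
    constructor
    · intro h c
      have := congrArg (fun w : EuclideanSpace ℂ (Conf p L) => w c) h
      simpa [transl_mulVec] using this
    · intro h
      ext c
      simpa [transl_mulVec] using h c
  rw [h]
  refine ⟨fun h f => ?_, fun h r c => by rw [← map_neg, h]⟩
  -- The gauge transformations fixing `v` form a subgroup, so it suffices that it contains the unit
  -- transformations at single sites, which generate everything.
  let S : AddSubgroup (Site L → ZMod p) :=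
    { carrier := {f | ∀ c, v (c + grad f) = v c}
      zero_mem' := fun c => by simp
      add_mem' := fun {f g} hf hg c => by
        rw [map_add, ← add_assoc, hg, hf]
      neg_mem' := fun {f} hf c => by
        rw [← hf (c + grad (-f)), map_neg, neg_add_cancel_right] }
  have hS : f ∈ S := by
    rw [← Finset.univ_sum_single f]
    refine S.sum_mem fun r _ => ?_
    have : (Pi.single r (f r) : Site L → ZMod p) = (f r).val • -(-Pi.single r 1) := by
      rw [neg_neg, ← Pi.single_smul, nsmul_eq_mul, ZMod.natCast_zmod_val, mul_one]
    rw [this]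
    refine S.nsmul_mem (S.neg_mem fun c => ?_) _
    rw [map_neg, h r c]
  exact hS

lemma gaugeSum_mulVec (v : Conf p L → ℂ) (c : Conf p L) :
    (gaugeSum p L *ᵥ v) c = ∑ f : Site L → ZMod p, v (c + grad f) := by
  simp [gaugeSum, Matrix.sum_mulVec, transl_mulVec, Finset.sum_apply]

/-- The average over the gauge group has invariant range, is Hermitian and fixes invariant vectors;
these properties characterise the orthogonal projector. -/
lemma projGI_eq : projGI p L = ((p : ℂ) ^ Fintype.card (Site L))⁻¹ • gaugeSum p L := by
  have hp : ((p : ℂ) ^ Fintype.card (Site L)) ≠ 0 := pow_ne_zero _ (NeZero.ne _)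
  set a : ℂ := ((p : ℂ) ^ Fintype.card (Site L))⁻¹ with ha
  have hstar : star a = a := by simp [ha]
  rw [projGI, LinearEquiv.symm_apply_eq]
  refine LinearMap.ext fun v => ?_
  rw [ContinuousLinearMap.coe_coe]
  refine Submodule.eq_starProjection_of_mem_of_inner_eq_zero ?_ fun w hw => ?_
  · rw [mem_gaugeInvariant_iff]
    intro f c
    simp only [Matrix.toLpLin_apply, Matrix.smul_mulVec, Pi.smul_apply, gaugeSum_mulVec]
    congr 1
    refine Fintype.sum_equiv (Equiv.addLeft f) _ _ fun g => ?_
    rw [Equiv.coe_addLeft, map_add, add_assoc]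
  · rw [mem_gaugeInvariant_iff] at hw
    have hPw : (a • gaugeSum p L) *ᵥ w.ofLp = w.ofLp := by
      funext c
      rw [Matrix.smul_mulVec, Pi.smul_apply, gaugeSum_mulVec]
      simp only [hw, Finset.sum_const, Finset.card_univ, Fintype.card_fun, ZMod.card, smul_eq_mul,
        nsmul_eq_mul, ha]
      push_cast
      rw [inv_mul_cancel_left₀ hp]
    rw [inner_sub_left, EuclideanSpace.inner_eq_star_dotProduct,
      EuclideanSpace.inner_eq_star_dotProduct, Matrix.toLpLin_apply, Matrix.star_mulVec,
      Matrix.conjTranspose_smul, conjTranspose_gaugeSum, hstar, dotProduct_comm w.ofLp (_ ᵥ* _),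
      ← Matrix.dotProduct_mulVec, hPw, dotProduct_comm, sub_self]

/-! ### The duality operator -/

/-- The pairing of configurations. -/
def dotHom (p : ℕ) (ι : Type*) [Fintype ι] : (ι → ZMod p) →+ (ι → ZMod p) →+ ZMod p :=
  AddMonoidHom.mk' (fun x => AddMonoidHom.mk' (fun y => x ⬝ᵥ y) (dotProduct_add x))
    fun x y => AddMonoidHom.ext fun z => add_dotProduct x y z

omit [NeZero p] in
lemma dotHom_apply {ι : Type*} [Fintype ι] (x y : ι → ZMod p) : dotHom p ι x y = x ⬝ᵥ y := rfl

omit [NeZero p] in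
lemma dotHom_nondegenerate {ι : Type*} [Fintype ι] (x : ι → ZMod p) (h : dotHom p ι x = 0) :
    x = 0 := by
  classical
  funext i
  simpa [dotHom_apply] using DFunLike.congr_fun h (Pi.single i 1)

/-- The form is the dot product with the reflected curl of `x`, so the character is trivial exactly
when that curl vanishes. -/
lemma sum_stdAddChar_dualForm (x : Conf p L) :
    ∑ c : Conf p L, (stdAddChar (dualForm c x) : ℂ) =
      if curl x = 0 then (Fintype.card (Conf p L) : ℂ) else 0 := by
  set y : Conf p L := fun l => curl x (reflect l.1, l.2) with hy
  have h : ∀ c : Conf p L, dualForm c x = dotHom p _ y c := by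
    intro c
    rw [dotHom_apply, dotProduct, dualForm, Fintype.sum_prod_type]
    refine Fintype.sum_equiv reflectEquiv _ _ fun r => ?_
    simp [hy, mul_comm]
  simp only [h]
  rw [sum_stdAddChar_pairing _ dotHom_nondegenerate]
  refine if_congr ⟨fun h0 => funext fun l => ?_, fun h0 => ?_⟩ rfl rfl
  · simpa [hy] using congrFun h0 (reflect l.1, l.2)
  · funext l; simp [hy, h0]

variable (p L) in
/-- The duality operator. -/
def dualityOp : Matrix (Conf p L) (Conf p L) ℂ :=
  Matrix.of fun c c' => ((p : ℂ) ^ (2 * Fintype.card (Site L)))⁻¹ * stdAddChar (dualForm c c')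

lemma dualityOp_apply (c c' : Conf p L) : dualityOp p L c c' =
    ((p : ℂ) ^ (2 * Fintype.card (Site L)))⁻¹ * stdAddChar (dualForm c c') := rfl

lemma conjTranspose_dualityOp : (dualityOp p L)ᴴ = dualityOp p L := by
  ext c c'
  rw [Matrix.conjTranspose_apply, dualityOp_apply, dualityOp_apply, dualForm_antisymm c c',
    ← conj_stdAddChar]
  simp

omit [NeZero p] in
lemma dualForm_sub_right (a b c : Conf p L) : dualForm a (b - c) = dualForm a b - dualForm a c := by
  rw [dualForm_antisymm, sub_eq_add_neg, dualForm_add_left, dualForm_neg_left,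
    dualForm_antisymm b, dualForm_antisymm c]
  ring

/-- The two normalisations give `p` to the power `-4` per site and the sum over the three links of
each site gives `+3`. One inverse factor `p` per site remains, as in the gauge average. -/
lemma dualityOp_mul_self : dualityOp p L * dualityOp p L = projGI p L := by
  have hp : (p : ℂ) ≠ 0 := NeZero.ne _
  ext c c'
  rw [projGI_eq, Matrix.smul_apply, gaugeSum_apply, Matrix.mul_apply]
  have h : ∀ k : Conf p L, dualityOp p L c k * dualityOp p L k c' =
      ((p : ℂ) ^ (4 * Fintype.card (Site L)))⁻¹ * stdAddChar (dualForm k (c' - c)) := by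
    intro k
    rw [dualityOp_apply, dualityOp_apply, dualForm_antisymm c k, dualForm_sub_right, sub_eq_add_neg,
      AddChar.map_add_eq_mul]
    have : 4 * Fintype.card (Site L) = 2 * Fintype.card (Site L) + 2 * Fintype.card (Site L) := by
      ring
    rw [this, pow_add, mul_inv]
    ring
  simp only [h, ← Finset.mul_sum, sum_stdAddChar_dualForm]
  split_ifs
  · simp only [Fintype.card_fun, ZMod.card, Fintype.card_prod, Fintype.card_fin, smul_eq_mul,
      mul_one]
    rw [show 4 * Fintype.card (Site L) = Fintype.card (Site L) + Fintype.card (Site L) * 3 by ring,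
      pow_add, mul_inv, Nat.cast_pow, mul_assoc, inv_mul_cancel₀ (pow_ne_zero _ hp), mul_one]
  · simp

lemma dualityOp_mul_opB (r : Site L) (μ : Fin 3) :
    dualityOp p L * opB r μ = opV (reflect r) μ * dualityOp p L := by
  ext c c'
  rw [opB_eq, opV_eq, Matrix.mul_diagonal, transl_mul_apply, dualityOp_apply, dualityOp_apply,
    dualForm_add_left, dualForm_single_left, AddChar.map_add_eq_mul, mul_assoc]

lemma dualityOp_mul_opV (r : Site L) (μ : Fin 3) :
    dualityOp p L * opV r μ = opB (reflect r) μ * dualityOp p L := by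
  ext c c'
  rw [opB_eq, opV_eq, Matrix.diagonal_mul, mul_transl_apply, dualityOp_apply, dualityOp_apply,
    dualForm_sub_right, dualForm_antisymm c (Pi.single _ _)]
  have h := dualForm_single_left (reflect r) μ c
  rw [reflect_reflect] at h
  rw [h, sub_neg_eq_add, AddChar.map_add_eq_mul]
  ring

/-! ### Intertwining of adjoints, energies and transfer matrices. -/

lemma opV_mul_conjTranspose (r : Site L) (μ : Fin 3) :
    opV r μ * (opV r μ)ᴴ = (1 : Matrix (Conf p L) (Conf p L) ℂ) := by
  rw [opV_eq, conjTranspose_transl, transl_mul, add_neg_cancel, transl_zero]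

lemma conjTranspose_opV_mul (r : Site L) (μ : Fin 3) :
    (opV r μ)ᴴ * opV r μ = (1 : Matrix (Conf p L) (Conf p L) ℂ) :=
  mul_eq_one_comm.1 (opV_mul_conjTranspose r μ)

lemma conjTranspose_opB_mul (r : Site L) (μ : Fin 3) :
    (opB r μ)ᴴ * opB r μ = (1 : Matrix (Conf p L) (Conf p L) ℂ) := by
  rw [opB_eq, Matrix.diagonal_conjTranspose, Matrix.diagonal_mul_diagonal, ← Matrix.diagonal_one]
  congr 1
  funext c
  simp only [Pi.star_apply, RCLike.star_def, conj_stdAddChar, ← AddChar.map_add_eq_mul,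
    neg_add_cancel, AddChar.map_zero_eq_one]

lemma opB_mul_conjTranspose (r : Site L) (μ : Fin 3) :
    opB r μ * (opB r μ)ᴴ = (1 : Matrix (Conf p L) (Conf p L) ℂ) :=
  mul_eq_one_comm.1 (conjTranspose_opB_mul r μ)

/-- `U` need not be invertible; unitarity of `A` and `B` alone carries the relation over to the
adjoints. -/
lemma mul_conjTranspose_of_mul {n : Type*} [Fintype n] [DecidableEq n] {U A B : Matrix n n ℂ}
    (h : U * A = B * U) (hA : A * Aᴴ = 1) (hB : Bᴴ * B = 1) : U * Aᴴ = Bᴴ * U := by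
  calc U * Aᴴ = Bᴴ * B * (U * Aᴴ) := by rw [hB, one_mul]
    _ = Bᴴ * (B * U * Aᴴ) := by simp only [mul_assoc]
    _ = Bᴴ * U := by rw [← h, mul_assoc U, hA, mul_one]

lemma dualityOp_mul_conjTranspose_opB (r : Site L) (μ : Fin 3) :
    dualityOp p L * (opB r μ)ᴴ = (opV (reflect r) μ)ᴴ * dualityOp p L :=
  mul_conjTranspose_of_mul (dualityOp_mul_opB r μ) (opB_mul_conjTranspose r μ)
    (conjTranspose_opV_mul _ μ)

lemma dualityOp_mul_conjTranspose_opV (r : Site L) (μ : Fin 3) :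
    dualityOp p L * (opV r μ)ᴴ = (opB (reflect r) μ)ᴴ * dualityOp p L :=
  mul_conjTranspose_of_mul (dualityOp_mul_opV r μ) (opV_mul_conjTranspose r μ)
    (conjTranspose_opB_mul _ μ)

variable (p L) in
/-- The electric energy. -/
def electricSum : Matrix (Conf p L) (Conf p L) ℂ :=
  ∑ r : Site L, ∑ μ : Fin 3, (opV r μ + (opV r μ)ᴴ)

variable (p L) in
/-- The magnetic energy. -/
def magneticSum : Matrix (Conf p L) (Conf p L) ℂ :=
  ∑ r : Site L, ∑ μ : Fin 3, (opB r μ + (opB r μ)ᴴ)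

lemma dualityOp_mul_electricSum :
    dualityOp p L * electricSum p L = magneticSum p L * dualityOp p L := by
  simp only [electricSum, magneticSum, Matrix.mul_sum, Matrix.sum_mul, mul_add, add_mul,
    dualityOp_mul_opV, dualityOp_mul_conjTranspose_opV]
  exact Fintype.sum_equiv reflectEquiv _ _ fun r => rfl

lemma dualityOp_mul_magneticSum :
    dualityOp p L * magneticSum p L = electricSum p L * dualityOp p L := by
  simp only [electricSum, magneticSum, Matrix.mul_sum, Matrix.sum_mul, mul_add, add_mul,
    dualityOp_mul_opB, dualityOp_mul_conjTranspose_opB]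
  exact Fintype.sum_equiv reflectEquiv _ _ fun r => rfl

lemma hamiltonian_eq (lam : ℝ) : hamiltonian p L lam =
    (1 / 2 : ℂ) • (electricSum p L + (lam : ℂ) • magneticSum p L) := by
  rw [hamiltonian, electricSum, magneticSum]
  congr 1
  simp only [Finset.smul_sum, ← Finset.sum_add_distrib]
  refine Finset.sum_congr rfl fun r _ => Finset.sum_congr rfl fun μ _ => ?_
  rw [Matrix.conjTranspose_add, Matrix.conjTranspose_smul, smul_add]
  simp only [RCLike.star_def, Complex.conj_ofReal]
  abel

lemma dualityOp_mul_hamiltonian {lam : ℝ} (hlam : lam ≠ 0) :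
    dualityOp p L * hamiltonian p L lam = (lam : ℂ) • (hamiltonian p L lam⁻¹ * dualityOp p L) := by
  have h : (lam : ℂ) ≠ 0 := Complex.ofReal_ne_zero.2 hlam
  rw [hamiltonian_eq, hamiltonian_eq]
  rw [Matrix.mul_smul, Matrix.smul_mul, mul_add, add_mul, Matrix.mul_smul, Matrix.smul_mul,
    dualityOp_mul_electricSum, dualityOp_mul_magneticSum]
  rw [smul_comm (lam : ℂ) (1 / 2 : ℂ), smul_add (lam : ℂ), smul_smul (lam : ℂ)]
  push_cast
  rw [mul_inv_cancel₀ h, one_smul, add_comm]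

lemma transferMatrix_eq (K κ : ℝ) : transferMatrix p L K κ =
    NormedSpace.exp (((κ / 2 : ℝ) : ℂ) • electricSum p L) *
      NormedSpace.exp (((K / 2 : ℝ) : ℂ) • magneticSum p L) := rfl

lemma mul_exp_of_mul {n : Type*} [Fintype n] [DecidableEq n] {U A B : Matrix n n ℂ}
    (h : U * A = B * U) (a : ℂ) :
    U * NormedSpace.exp (a • A) = NormedSpace.exp (a • B) * U := by
  open scoped Matrix.Norms.Operator in
  exact SemiconjBy.exp_right (show SemiconjBy U (a • A) (a • B) by
    rw [SemiconjBy, Matrix.mul_smul, Matrix.smul_mul, h])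

/-- Self-duality of the partition function in the transfer-matrix form. -/
lemma trace_transferMatrix_pow_swap (K κ : ℝ) (n : ℕ) :
    Matrix.trace (transferMatrix p L K κ ^ n * projGI p L) =
      Matrix.trace (transferMatrix p L κ K ^ n * projGI p L) := by
  set U := dualityOp p L with hU
  set E₁ := NormedSpace.exp (((κ / 2 : ℝ) : ℂ) • electricSum p L) with hE₁
  set B₁ := NormedSpace.exp (((K / 2 : ℝ) : ℂ) • magneticSum p L) with hB₁
  set E₂ := NormedSpace.exp (((K / 2 : ℝ) : ℂ) • electricSum p L) with hE₂
  set B₂ := NormedSpace.exp (((κ / 2 : ℝ) : ℂ) • magneticSum p L) with hB₂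
  have h1 : U * E₁ = B₂ * U := mul_exp_of_mul dualityOp_mul_electricSum _
  have h2 : U * B₁ = E₂ * U := mul_exp_of_mul dualityOp_mul_magneticSum _
  have h3 : U * E₂ = B₁ * U := mul_exp_of_mul dualityOp_mul_electricSum _
  have h4 : U * B₂ = E₁ * U := mul_exp_of_mul dualityOp_mul_magneticSum _
  -- `U` has a kernel in general, so it cannot be used as a similarity. Its square commutes with
  -- `B₂` because it exchanges the two energies twice.
  have hPB : Commute (U * U) B₂ := by
    rw [Commute, SemiconjBy, mul_assoc, h4, ← mul_assoc, h1, mul_assoc]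
  have hT : SemiconjBy U (E₁ * B₁) (B₂ * E₂) := by
    rw [SemiconjBy, ← mul_assoc, h1, mul_assoc, h2, mul_assoc]
  have hT' : SemiconjBy B₂ (E₂ * B₂) (B₂ * E₂) := by
    rw [SemiconjBy, mul_assoc]
  rw [transferMatrix_eq, transferMatrix_eq, ← dualityOp_mul_self, ← hU]
  -- One factor `U` is cycled to the front and pushed through the power, which leaves the dual
  -- factors in the reversed order `B₂ * E₂`. Conjugation by the invertible `B₂` then restores the
  -- order.
  rw [← mul_assoc, Matrix.trace_mul_comm, ← mul_assoc, (hT.pow_right n).eq, mul_assoc]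
  obtain ⟨b, hb⟩ : IsUnit B₂ := Matrix.isUnit_exp _
  calc Matrix.trace ((B₂ * E₂) ^ n * (U * U))
      = Matrix.trace ((B₂ * E₂) ^ n * B₂ * ((↑b⁻¹ : Matrix _ _ ℂ) * (U * U))) := by
        rw [← hb, mul_assoc, Units.mul_inv_cancel_left]
    _ = Matrix.trace ((E₂ * B₂) ^ n * ((↑b⁻¹ : Matrix _ _ ℂ) * (U * U * B₂))) := by
        rw [← (hT'.pow_right n).eq, mul_assoc, Matrix.trace_mul_comm]
        simp only [mul_assoc]
    _ = Matrix.trace ((E₂ * B₂) ^ n * (U * U)) := by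
        rw [hPB.eq, ← hb, Units.inv_mul_cancel_left]

end Quantum

/-! ### The transfer matrix in the product basis -/

section Kernels

variable {p : ℕ} [NeZero p] {L : Fin 3 → ℕ}

open ZMod (stdAddChar)

/-- The magnetic Boltzmann weight as a function on `ℤ_p`. -/
def magWeight (p : ℕ) [NeZero p] (K : ℝ) (z : ZMod p) : ℝ :=
  Real.exp (K * (stdAddChar z : ℂ).re)

lemma stdAddChar_sum {ι : Type*} (s : Finset ι) (f : ι → ZMod p) :
    (stdAddChar (∑ i ∈ s, f i) : ℂ) = ∏ i ∈ s, stdAddChar (f i) := by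
  classical
  induction s using Finset.induction_on with
  | empty => simp
  | insert a s ha ih => rw [Finset.sum_insert ha, Finset.prod_insert ha, AddChar.map_add_eq_mul, ih]

/-- The Fourier sum over configurations factorises over links, each link contributing one
one-variable transform. -/
lemma exp_electricSum_apply (κ : ℝ) (c c' : Conf p L) :
    NormedSpace.exp (((κ / 2 : ℝ) : ℂ) • electricSum p L) c c' =
      ((∏ l, weight p κ (c' l - c l) : ℝ) : ℂ) := by
  have h : electricSum p L = ∑ l : Site L × Fin 3,
      (transl (Pi.single l 1 : Conf p L) + (transl (Pi.single l 1 : Conf p L))ᴴ) := by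
    rw [electricSum, Fintype.sum_prod_type]
    simp only [opV_eq]
  have hw : ∀ l, ((weight p κ (c' l - c l) : ℝ) : ℂ) = (p : ℂ)⁻¹ * ∑ k : ZMod p,
      stdAddChar ((c l - c' l) * k) * Complex.exp (((κ * Real.cos (angle p k.val) : ℝ) : ℂ)) := by
    intro l
    rw [← weight_eq, ← neg_sub, weight_neg]
  rw [h, exp_sum_transl (dotHom p _) dotHom_nondegenerate, Complex.ofReal_prod]
  simp only [hw, Finset.prod_mul_distrib, Finset.prod_const, Finset.card_univ, Fintype.card_fun,
    ZMod.card]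
  rw [Finset.prod_univ_sum, Fintype.piFinset_univ, Nat.cast_pow, inv_pow]
  congr 1
  refine Finset.sum_congr rfl fun k _ => ?_
  simp only [dotHom_apply, single_one_dotProduct, Finset.prod_mul_distrib]
  congr 1
  · rw [dotProduct, stdAddChar_sum]
    rfl
  · rw [Finset.mul_sum, ← Complex.exp_sum, Complex.ofReal_sum]

lemma exp_magneticSum (K : ℝ) :
    NormedSpace.exp (((K / 2 : ℝ) : ℂ) • magneticSum p L) =
      Matrix.diagonal fun c : Conf p L => ((∏ l, magWeight p K (curl c l) : ℝ) : ℂ) := by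
  have h : ((K / 2 : ℝ) : ℂ) • magneticSum p L = Matrix.diagonal fun c : Conf p L =>
      ((∑ l, K * (stdAddChar (curl c l) : ℂ).re : ℝ) : ℂ) := by
    ext c c'
    rw [magneticSum, Matrix.smul_apply, ← Fintype.sum_prod_type'
      (f := fun (r : Site L) (μ : Fin 3) => opB r μ + (opB r μ)ᴴ), Matrix.sum_apply]
    simp only [opB_eq, Matrix.diagonal_conjTranspose, Matrix.diagonal_add]
    rcases eq_or_ne c c' with rfl | hne
    · simp only [Matrix.diagonal_apply_eq, Pi.star_apply, RCLike.star_def, conj_stdAddChar,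
        stdAddChar_add_neg, cos_angle_val, smul_eq_mul]
      push_cast
      rw [← Finset.mul_sum, ← Finset.mul_sum]
      ring
    · simp [Matrix.diagonal_apply_ne _ hne]
  rw [h, Matrix.exp_diagonal, Pi.exp_def]
  congr 1
  funext c
  rw [← Complex.exp_eq_exp_ℂ, ← Complex.ofReal_exp, Real.exp_sum]
  rfl

/-- One time step: the gauge-averaged transfer matrix. -/
lemma step_apply (K κ : ℝ) (c c' : Conf p L) :
    (NormedSpace.exp (((κ / 2 : ℝ) : ℂ) • electricSum p L) * gaugeSum p L *
      NormedSpace.exp (((K / 2 : ℝ) : ℂ) • magneticSum p L)) c c' =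
      ((∑ f : Site L → ZMod p, (∏ l, weight p κ (c' l - grad f l - c l)) *
        ∏ l, magWeight p K (curl c' l) : ℝ) : ℂ) := by
  rw [exp_magneticSum, Matrix.mul_diagonal, gaugeSum, Matrix.mul_sum, Matrix.sum_apply]
  simp only [mul_transl_apply, exp_electricSum_apply, Pi.sub_apply]
  rw [← Finset.sum_mul]
  push_cast
  rfl

lemma projGI_mul_self : projGI p L * projGI p L = projGI p L := by
  ext c c'
  have h : gaugeSum p L * gaugeSum p L = ((p : ℂ) ^ Fintype.card (Site L)) • gaugeSum p L := by
    nth_rw 1 [gaugeSum]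
    rw [Matrix.sum_mul]
    have : ∀ f : Site L → ZMod p, transl (grad f) * gaugeSum p L = gaugeSum p L := by
      intro f
      rw [gaugeSum, Matrix.mul_sum]
      refine Fintype.sum_equiv (Equiv.addLeft f) _ _ fun g => ?_
      rw [transl_mul, Equiv.coe_addLeft, map_add]
    simp only [this, Finset.sum_const, Finset.card_univ, Fintype.card_fun, ZMod.card]
    rw [← Nat.cast_smul_eq_nsmul ℂ, Nat.cast_pow]
  have hp : ((p : ℂ) ^ Fintype.card (Site L)) ≠ 0 := pow_ne_zero _ (NeZero.ne _)
  rw [projGI_eq, Matrix.smul_mul, Matrix.mul_smul, h, smul_smul (_ ⁻¹) (_ ^ _), inv_mul_cancel₀ hp,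
    one_smul]

/-- A periodic product of steps is the trace of a power of the transfer matrix. -/
lemma trace_step_pow (K κ : ℝ) (n : ℕ) :
    Matrix.trace ((NormedSpace.exp (((κ / 2 : ℝ) : ℂ) • electricSum p L) * gaugeSum p L *
      NormedSpace.exp (((K / 2 : ℝ) : ℂ) • magneticSum p L)) ^ (n + 1)) =
      (p : ℂ) ^ (Fintype.card (Site L) * (n + 1)) *
        Matrix.trace (transferMatrix p L K κ ^ (n + 1) * projGI p L) := by
  have hp : ((p : ℂ) ^ Fintype.card (Site L)) ≠ 0 := pow_ne_zero _ (NeZero.ne _)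
  set E := NormedSpace.exp (((κ / 2 : ℝ) : ℂ) • electricSum p L) with hE
  set B := NormedSpace.exp (((K / 2 : ℝ) : ℂ) • magneticSum p L) with hB
  set U := dualityOp p L with hU
  -- Gauge invariance of both exponentials follows from duality: the projector is `U * U`, and each
  -- `U` swaps the electric and magnetic energies.
  have hUE : Commute (U * U) E := by
    have h1 : U * E = _ := mul_exp_of_mul dualityOp_mul_electricSum _
    have h2 := mul_exp_of_mul (U := U) dualityOp_mul_magneticSum ((κ / 2 : ℝ) : ℂ)
    rw [Commute, SemiconjBy, mul_assoc, h1, ← mul_assoc, h2, mul_assoc]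
  have hUB : Commute (U * U) B := by
    have h1 : U * B = _ := mul_exp_of_mul dualityOp_mul_magneticSum _
    have h2 := mul_exp_of_mul (U := U) dualityOp_mul_electricSum ((K / 2 : ℝ) : ℂ)
    rw [Commute, SemiconjBy, mul_assoc, h1, ← mul_assoc, h2, mul_assoc]
  rw [dualityOp_mul_self] at hUE hUB
  have hQ : gaugeSum p L = ((p : ℂ) ^ Fintype.card (Site L)) • projGI p L := by
    rw [projGI_eq, smul_smul, mul_inv_cancel₀ hp, one_smul]
  have hpow : ∀ k : ℕ, projGI p L ^ (k + 1) = projGI p L := by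
    intro k
    induction k with
    | zero => simp
    | succ k ih => rw [pow_succ, ih, projGI_mul_self]
  have hstep : E * gaugeSum p L * B =
      ((p : ℂ) ^ Fintype.card (Site L)) • (transferMatrix p L K κ * projGI p L) := by
    rw [hQ, Matrix.mul_smul, Matrix.smul_mul, transferMatrix_eq, mul_assoc, mul_assoc, hUB.eq]
  have hc : Commute (transferMatrix p L K κ) (projGI p L) := (hUE.mul_right hUB).symm
  rw [hstep, smul_pow, Matrix.trace_smul, smul_eq_mul, hc.mul_pow, hpow, pow_mul]

/-! ### Matrix powers as sums over paths. -/

lemma pow_succ_apply_eq_sum {ι R : Type*} [Fintype ι] [DecidableEq ι] [CommSemiring R]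
    (A : Matrix ι ι R) (n : ℕ) (i j : ι) :
    (A ^ (n + 1)) i j = ∑ c : Fin n → ι, ∏ t : Fin (n + 1),
      A ((Fin.cons i c : Fin (n + 1) → ι) t) ((Fin.snoc c j : Fin (n + 1) → ι) t) := by
  induction n generalizing i with
  | zero => simp [Fin.snoc]
  | succ n ih =>
    rw [pow_succ', Matrix.mul_apply, ← (Fin.consEquiv fun _ => ι).sum_comp, Fintype.sum_prod_type]
    refine Finset.sum_congr rfl fun k _ => ?_
    rw [ih, Finset.mul_sum]
    refine Finset.sum_congr rfl fun c _ => ?_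
    change _ = ∏ t, A ((Fin.cons i (Fin.cons k c : Fin (n + 1) → ι) : Fin (n + 2) → ι) t)
      ((Fin.snoc (Fin.cons k c : Fin (n + 1) → ι) j : Fin (n + 2) → ι) t)
    rw [Fin.prod_univ_succ (n := n + 1), ← Fin.cons_snoc_eq_snoc_cons]
    simp

/-- The trace of a power as a sum over closed paths. -/
lemma trace_pow_succ_eq_sum {ι R : Type*} [Fintype ι] [DecidableEq ι] [CommSemiring R]
    (A : Matrix ι ι R) (n : ℕ) :
    Matrix.trace (A ^ (n + 1)) =
      ∑ c : Fin (n + 1) → ι, ∏ t, A (c t) (c (finRotate (n + 1) t)) := by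
  rw [Matrix.trace, ← (Fin.consEquiv fun _ => ι).sum_comp, Fintype.sum_prod_type]
  refine Finset.sum_congr rfl fun i _ => ?_
  rw [Matrix.diag_apply, pow_succ_apply_eq_sum]
  refine Finset.sum_congr rfl fun c _ => Finset.prod_congr rfl fun t _ => ?_
  rw [Fin.snoc_eq_cons_rotate]
  rfl

end Kernels

/-! ### The partition function as a sum of products of local weights -/

section Classical

variable {p : ℕ} [NeZero p]

open ZMod (stdAddChar)

/-- The plaquette variable in `ℤ_p`. -/
def plaq {d : ℕ} {N : Fin d → ℕ} (P : Finset (Fin d)) (s : Site N → Fin d → ZMod p) (r : Site N)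
    (μ ν : Fin d) : ZMod p :=
  s r μ + (forward P μ r).elim 0 (fun x => s x ν) - (forward P ν r).elim 0 (fun x => s x μ) - s r ν

/-- Since `m` is an integer, the cosine sees the plaquette angle only modulo `2π`, so the real sum
of representatives may be replaced by its class in `ZMod p`. -/
lemma cos_mul_plaquetteAngle {d : ℕ} {N : Fin d → ℕ} (P : Finset (Fin d))
    (s : Site N → Fin d → ZMod p) (r : Site N) (μ ν : Fin d) (m : ℕ) :
    Real.cos (m * plaquetteAngle P (fun r μ => angle p (s r μ).val) r μ ν) =
      (stdAddChar ((m : ZMod p) * plaq P s r μ ν) : ℂ).re := by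
  have h : ∀ (o : Option (Site N)) (ρ : Fin d),
      atSite (fun x => angle p (s x ρ).val) o = angle p (o.elim 0 fun x => s x ρ).val := by
    intro o ρ
    cases o <;> simp [atSite, angle]
  rw [plaquetteAngle, h, h, plaq]
  generalize (s r μ) = a
  generalize (s r ν) = b
  generalize ((forward P μ r).elim 0 fun x => s x ν) = c
  generalize ((forward P ν r).elim 0 fun x => s x μ) = d
  have := re_stdAddChar_intCast (p := p) (m * (a.val + c.val - d.val - b.val))
  push_cast at this
  simp only [ZMod.natCast_zmod_val] at this
  rw [this]
  congr 1
  simp only [angle]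
  ring

/-- The Boltzmann weight of the plaquettes at one site. -/
def siteWeight {N : Fin 4 → ℕ} (P : Finset (Fin 4)) (K κ : ℝ) (s : Site N → Fin 4 → ZMod p)
    (r : Site N) : ℝ :=
  (magWeight p K (plaq P s r 0 1) * magWeight p K (plaq P s r 1 2) *
    magWeight p K (plaq P s r 2 0)) *
  (weight p κ (plaq P s r 3 0) * weight p κ (plaq P s r 3 1) * weight p κ (plaq P s r 3 2))

lemma exp_sum_epsilonCoeff {κ : ℝ} (hκ : 0 < κ) (z : ZMod p) :
    Real.exp (∑ m ∈ Finset.range p, epsilonCoeff p κ m *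
      (stdAddChar ((m : ZMod p) * z) : ℂ).re) = weight p κ z := by
  rw [weight, ← exp_logDualWeight hκ, logDualWeight_eq_sum]
  congr 1
  refine Finset.sum_congr rfl fun m _ => ?_
  rw [cos_mul_angle, ZMod.natCast_zmod_val, mul_comm z]

lemma partitionFunction_eq (N : Fin 4 → ℕ) (P : Finset (Fin 4)) (K : ℝ) {κ : ℝ} (hκ : 0 < κ) :
    partitionFunction p N P K κ =
      ∑ s : Site N → Fin 4 → ZMod p, ∏ r, siteWeight P K κ s r := by
  rw [partitionFunction]
  refine Finset.sum_congr rfl fun s _ => ?_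
  have h1 : ∀ (r : Site N) (μ ν : Fin 4),
      Real.cos (plaquetteAngle P (fun r μ => angle p (s r μ).val) r μ ν) =
        (stdAddChar (plaq P s r μ ν) : ℂ).re := by
    intro r μ ν
    simpa using cos_mul_plaquetteAngle P s r μ ν 1
  simp only [h1, cos_mul_plaquetteAngle]
  rw [Real.exp_sum, Real.exp_sum, ← Finset.prod_mul_distrib]
  refine Finset.prod_congr rfl fun r _ => ?_
  simp only [siteWeight, ← exp_sum_epsilonCoeff hκ, magWeight, ← Real.exp_add, mul_add,
    Finset.sum_add_distrib]

/-! ### Splitting off the time direction -/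

/-- The site with given space and time coordinates. -/
def joinSite {d : ℕ} {N : Fin (d + 1) → ℕ} (x : Site fun i : Fin d => N i.castSucc)
    (t : Fin (N (Fin.last d))) : Site N :=
  Fin.snoc (α := fun i => Fin (N i)) x t

/-- Sites as pairs of a time and a point of space. -/
def joinSiteEquiv {d : ℕ} (N : Fin (d + 1) → ℕ) :
    Fin (N (Fin.last d)) × (Site fun i : Fin d => N i.castSucc) ≃ Site N :=
  Fin.snocEquiv fun i => Fin (N i)

lemma joinSiteEquiv_apply {d : ℕ} {N : Fin (d + 1) → ℕ}
    (q : Fin (N (Fin.last d)) × (Site fun i : Fin d => N i.castSucc)) :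
    joinSiteEquiv N q = joinSite q.2 q.1 := rfl

lemma forward_joinSite_castSucc {d : ℕ} {N : Fin (d + 1) → ℕ} (μ : Fin d)
    (x : Site fun i : Fin d => N i.castSucc) (t : Fin (N (Fin.last d))) :
    forward {Fin.last d} μ.castSucc (joinSite x t) =
      (forward ∅ μ x).map fun y => joinSite y t := by
  have h0 : (joinSite x t) μ.castSucc = x μ := Fin.snoc_castSucc (α := fun i => Fin (N i)) _ _ _
  have hne : μ.castSucc ≠ Fin.last d := (Fin.castSucc_lt_last μ).ne
  unfold forward
  simp only [h0, Finset.mem_singleton, hne, if_false, Finset.notMem_empty]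
  split_ifs with h
  · rw [Option.map_some]
    congr 1
    exact (Fin.snoc_update (α := fun i => Fin (N i)) _ _ _ _).symm
  · rfl

lemma forward_joinSite_last {d : ℕ} {N : Fin (d + 1) → ℕ}
    (x : Site fun i : Fin d => N i.castSucc) (t : Fin (N (Fin.last d))) :
    forward {Fin.last d} (Fin.last d) (joinSite x t) =
      some (joinSite x (finRotate (N (Fin.last d)) t)) := by
  have h0 : (joinSite x t) (Fin.last d) = t := Fin.snoc_last (α := fun i => Fin (N i)) _ _
  have h1 : ∀ u, Function.update (joinSite x t) (Fin.last d) u = joinSite x u :=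
    fun u => Fin.update_snoc_last (α := fun i => Fin (N i)) _ _ _
  have h2 : ∀ (n : ℕ) (t : Fin n), (finRotate n t : ℕ) = if (t : ℕ) + 1 < n then (t : ℕ) + 1 else 0 := by
    intro n t
    cases n with
    | zero => exact t.elim0
    | succ n =>
      split_ifs with h
      · rw [finRotate_of_lt (k := t) (by omega)]
      · have : t = Fin.last n := Fin.ext (by have := t.isLt; simp; omega)
        rw [this, finRotate_last]; rfl
  unfold forward
  simp only [h0, h1, Finset.mem_singleton, if_true]
  split_ifs with h
  · congr 2
    exact Fin.ext (by rw [h2, if_pos h])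
  · congr 2
    exact Fin.ext (by rw [h2, if_neg h])

variable {N : Fin 4 → ℕ}

/-- Link variables as spatial link variables and temporal link variables at every time. -/
def splitField (p : ℕ) (N : Fin 4 → ℕ) : (Site N → Fin 4 → ZMod p) ≃
    (Fin (N 3) → Conf p fun i : Fin 3 => N i.castSucc) ×
      (Fin (N 3) → (Site fun i : Fin 3 => N i.castSucc) → ZMod p) where
  toFun s := (fun t l => s (joinSite l.1 t) l.2.castSucc, fun t x => s (joinSite x t) 3)
  invFun q r := Fin.snoc (α := fun _ => ZMod p)
    (fun μ => q.1 ((joinSiteEquiv N).symm r).1 (((joinSiteEquiv N).symm r).2, μ))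
    (q.2 ((joinSiteEquiv N).symm r).1 ((joinSiteEquiv N).symm r).2)
  left_inv s := by
    funext r μ
    obtain ⟨q, rfl⟩ := (joinSiteEquiv N).surjective r
    simp only [Equiv.symm_apply_apply]
    refine Fin.lastCases ?_ (fun μ => ?_) μ
    · rw [Fin.snoc_last]; rfl
    · rw [Fin.snoc_castSucc]; rfl
  right_inv q := by
    have h : ∀ x t, (joinSiteEquiv N).symm (joinSite x t) = (t, x) := fun x t =>
      (Equiv.symm_apply_eq _).2 rfl
    refine Prod.ext (funext fun t => funext fun l => ?_) (funext fun t => funext fun x => ?_)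
    · simp only [h, Fin.snoc_castSucc]
    · simp only [h]
      exact Fin.snoc_last (α := fun _ => ZMod p) _ _

omit [NeZero p] in
lemma plaq_space (s : Site N → Fin 4 → ZMod p) (x : Site fun i : Fin 3 => N i.castSucc)
    (t : Fin (N 3)) (μ : Fin 3) :
    plaq {3} s (joinSite x t) (μ + 1).castSucc (μ + 2).castSucc =
      curl ((splitField p N s).1 t) (x, μ) := by
  have h := fun ν : Fin 3 => forward_joinSite_castSucc (N := N) ν x t
  change plaq {Fin.last 3} s (joinSite x t) (μ + 1).castSucc (μ + 2).castSucc = _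
  rw [plaq, h, h, curl_apply, diff_apply, diff_apply, hop, hop]
  simp only [Option.elim_map, Function.comp_def, splitField, Equiv.coe_fn_mk]
  abel

omit [NeZero p] in
-- The temporal links enter only through their spatial gradient, as a gauge transformation relating
-- the slices at `t` and at the following time.
lemma plaq_time (s : Site N → Fin 4 → ZMod p) (x : Site fun i : Fin 3 => N i.castSucc)
    (t : Fin (N 3)) (μ : Fin 3) :
    plaq {3} s (joinSite x t) 3 μ.castSucc =
      (splitField p N s).1 (finRotate _ t) (x, μ) - grad ((splitField p N s).2 t) (x, μ) -
        (splitField p N s).1 t (x, μ) := by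
  have h := forward_joinSite_castSucc (N := N) μ x t
  have h' := forward_joinSite_last (N := N) x t
  change plaq {Fin.last 3} s (joinSite x t) (Fin.last 3) μ.castSucc = _
  rw [plaq, h, h', grad_apply, diff_apply, hop]
  simp only [Option.elim_map, Function.comp_def, splitField, Equiv.coe_fn_mk, Option.elim_some]
  change s (joinSite x t) 3 + s (joinSite x (finRotate (N 3) t)) μ.castSucc -
    (forward ∅ μ x).elim 0 (fun y => s (joinSite y t) 3) - _ = _
  abel

lemma prod_siteWeight (K κ : ℝ) (s : Site N → Fin 4 → ZMod p) :
    ∏ r, siteWeight {3} K κ s r = ∏ t : Fin (N 3),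
      ((∏ l, weight p κ ((splitField p N s).1 (finRotate _ t) l -
          grad ((splitField p N s).2 t) l - (splitField p N s).1 t l)) *
        ∏ l, magWeight p K (curl ((splitField p N s).1 (finRotate _ t)) l)) := by
  -- Periodicity in time allows the magnetic weight to be read on the later slice, matching the
  -- order of the factors in `step_apply`.
  rw [Finset.prod_mul_distrib, Equiv.prod_comp (finRotate (N 3))
    fun t => ∏ l, magWeight p K (curl ((splitField p N s).1 t) l), ← Finset.prod_mul_distrib,
    ← (joinSiteEquiv N).prod_comp, Fintype.prod_prod_type]
  refine Finset.prod_congr rfl fun t _ => ?_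
  rw [Fintype.prod_prod_type, Fintype.prod_prod_type, ← Finset.prod_mul_distrib]
  refine Finset.prod_congr rfl fun x _ => ?_
  rw [joinSiteEquiv_apply]
  have hs := plaq_space s x t
  have ht := plaq_time s x t
  rw [Fin.prod_univ_three, Fin.prod_univ_three, ← hs, ← hs, ← hs, ← ht, ← ht, ← ht]
  change (magWeight p K (plaq {3} s (joinSite x t) 0 1) *
    magWeight p K (plaq {3} s (joinSite x t) 1 2) * magWeight p K (plaq {3} s (joinSite x t) 2 0)) *
    (weight p κ (plaq {3} s (joinSite x t) 3 0) * weight p κ (plaq {3} s (joinSite x t) 3 1) *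
      weight p κ (plaq {3} s (joinSite x t) 3 2)) =
    (weight p κ (plaq {3} s (joinSite x t) 3 0) * weight p κ (plaq {3} s (joinSite x t) 3 1) *
      weight p κ (plaq {3} s (joinSite x t) 3 2)) *
    (magWeight p K (plaq {3} s (joinSite x t) 1 2) *
    magWeight p K (plaq {3} s (joinSite x t) 2 0) * magWeight p K (plaq {3} s (joinSite x t) 0 1))
  ring

/-- The partition function in terms of the transfer matrix. -/
theorem Z_sdG_eq_trace (hN : 0 < N 3) (K : ℝ) {κ : ℝ} (hκ : 0 < κ) :
    ((Z_sdG p N K κ : ℝ) : ℂ) = (p : ℂ) ^ (∏ i, N i) *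
      Matrix.trace (transferMatrix p (fun i : Fin 3 => N i.castSucc) K κ ^ N 3 *
        projGI p (fun i : Fin 3 => N i.castSucc)) := by
  obtain ⟨n, hn⟩ : ∃ n, N 3 = n + 1 := ⟨N 3 - 1, by omega⟩
  have hcard : ∏ i, N i = Fintype.card (Site fun i : Fin 3 => N i.castSucc) * (n + 1) := by
    rw [Fin.prod_univ_castSucc, ← hn]
    simp [Fintype.card_pi]
  rw [hcard, hn, ← trace_step_pow, trace_pow_succ_eq_sum, Z_sdG, partitionFunction_eq _ _ _ hκ]
  simp only [prod_siteWeight, step_apply]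
  rw [(splitField p N).sum_comp (fun q => ∏ t : Fin (N 3),
      ((∏ l, weight p κ (q.1 (finRotate _ t) l - grad (q.2 t) l - q.1 t l)) *
        ∏ l, magWeight p K (curl (q.1 (finRotate _ t)) l))), Fintype.sum_prod_type]
  generalize N 3 = T at hn
  subst hn
  simp only [← Complex.ofReal_prod, ← Complex.ofReal_sum]
  congr 1
  refine Finset.sum_congr rfl fun c _ => ?_
  -- Independent gauge sums at each time step combine into one sum over all temporal links.
  rw [Finset.prod_univ_sum, Fintype.piFinset_univ]

end Classical

/-! ### Comparison of boundary conditions -/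

section Boundary

variable {p : ℕ} [NeZero p]

lemma exists_forall_le_mul {α : Type*} [Finite α] (f : α → ℝ) (hf : ∀ a, 0 < f a) :
    ∃ R : ℝ, 1 ≤ R ∧ ∀ a b, f a ≤ R * f b := by
  obtain ⟨R, hR⟩ := (Set.finite_range fun q : α × α => f q.1 / f q.2).bddAbove
  refine ⟨max 1 R, le_max_left _ _, fun a b => ?_⟩
  rw [← div_le_iff₀ (hf b)]
  exact (hR ⟨(a, b), rfl⟩).trans (le_max_right _ _)

lemma magWeight_pos (K : ℝ) (z : ZMod p) : 0 < magWeight p K z := Real.exp_pos _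

lemma siteWeight_pos {N : Fin 4 → ℕ} (P : Finset (Fin 4)) (K : ℝ) {κ : ℝ} (hκ : 0 < κ)
    (s : Site N → Fin 4 → ZMod p) (r : Site N) : 0 < siteWeight P K κ s r := by
  have h1 := fun z : ZMod p => magWeight_pos K z
  have h2 := fun z : ZMod p => weight_pos hκ z
  exact mul_pos (mul_pos (mul_pos (h1 _) (h1 _)) (h1 _)) (mul_pos (mul_pos (h2 _) (h2 _)) (h2 _))

/-- Two choices of boundary conditions change the weight at a site by a bounded factor. -/
lemma exists_siteWeight_le (K : ℝ) {κ : ℝ} (hκ : 0 < κ) : ∃ R : ℝ, 1 ≤ R ∧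
    ∀ (N : Fin 4 → ℕ) (P P' : Finset (Fin 4)) (s : Site N → Fin 4 → ZMod p) (r : Site N),
      siteWeight P K κ s r ≤ R * siteWeight P' K κ s r := by
  -- The weight at a site depends on only six elements of `ZMod p`, so the constant is uniform in
  -- the lattice size and the boundary condition.
  obtain ⟨R, h1R, hR⟩ := exists_forall_le_mul
    (fun a : (ZMod p × ZMod p × ZMod p) × (ZMod p × ZMod p × ZMod p) =>
      (magWeight p K a.1.1 * magWeight p K a.1.2.1 * magWeight p K a.1.2.2) *
      (weight p κ a.2.1 * weight p κ a.2.2.1 * weight p κ a.2.2.2)) fun a => by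
        have h1 := fun z : ZMod p => magWeight_pos K z
        have h2 := fun z : ZMod p => weight_pos hκ z
        exact mul_pos (mul_pos (mul_pos (h1 _) (h1 _)) (h1 _)) (mul_pos (mul_pos (h2 _) (h2 _)) (h2 _))
  exact ⟨R, h1R, fun N P P' s r => hR
    ((plaq P s r 0 1, plaq P s r 1 2, plaq P s r 2 0),
      (plaq P s r 3 0, plaq P s r 3 1, plaq P s r 3 2))
    ((plaq P' s r 0 1, plaq P' s r 1 2, plaq P' s r 2 0),
      (plaq P' s r 3 0, plaq P' s r 3 1, plaq P' s r 3 2))⟩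

/-- The sites with a last coordinate. -/
def boundary (N : Fin 4 → ℕ) : Finset (Site N) :=
  Finset.univ.filter fun r => ∃ μ, (r μ : ℕ) + 1 = N μ

lemma siteWeight_congr {N : Fin 4 → ℕ} (P P' : Finset (Fin 4)) (K κ : ℝ)
    (s : Site N → Fin 4 → ZMod p) {r : Site N} (hr : r ∉ boundary N) :
    siteWeight P K κ s r = siteWeight P' K κ s r := by
  have h : ∀ μ, forward P μ r = forward P' μ r := by
    intro μ
    have h1 : (r μ : ℕ) + 1 < N μ := by
      have h2 := (r μ).isLt
      have h3 : (r μ : ℕ) + 1 ≠ N μ := fun h => hr (by simpa [boundary] using ⟨μ, h⟩)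
      omega
    rw [forward, forward, dif_pos h1, dif_pos h1]
  simp only [siteWeight, plaq, h]

lemma partitionFunction_pos (N : Fin 4 → ℕ) (P : Finset (Fin 4)) (K : ℝ) {κ : ℝ} (hκ : 0 < κ) :
    0 < partitionFunction p N P K κ := by
  rw [partitionFunction_eq _ _ _ hκ]
  exact Finset.sum_pos (fun s _ => Finset.prod_pos fun r _ => siteWeight_pos P K hκ s r)
    Finset.univ_nonempty

/-- The configurations summed over do not depend on the boundary condition, so the comparison is
termwise, with one factor `R` for each boundary site; `C` is `log R`. -/
lemma exists_abs_log_sub_le (p : ℕ) [NeZero p] (K : ℝ) {κ : ℝ} (hκ : 0 < κ) : ∃ C : ℝ, 0 ≤ C ∧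
    ∀ (N : Fin 4 → ℕ) (P P' : Finset (Fin 4)),
      |Real.log (partitionFunction p N P K κ) - Real.log (partitionFunction p N P' K κ)| ≤
        C * (boundary N).card := by
  obtain ⟨R, h1R, hR⟩ := exists_siteWeight_le (p := p) K hκ
  have hR0 : 0 < R := by linarith
  have key : ∀ (N : Fin 4 → ℕ) (P P' : Finset (Fin 4)),
      Real.log (partitionFunction p N P K κ) ≤
        Real.log R * (boundary N).card + Real.log (partitionFunction p N P' K κ) := by
    intro N P P'
    have hle : partitionFunction p N P K κ ≤
        R ^ (boundary N).card * partitionFunction p N P' K κ := by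
      rw [partitionFunction_eq _ _ _ hκ, partitionFunction_eq _ _ _ hκ, Finset.mul_sum]
      refine Finset.sum_le_sum fun s _ => ?_
      have hpow : R ^ (boundary N).card = ∏ r, if r ∈ boundary N then R else 1 := by
        rw [Finset.prod_ite_mem, Finset.univ_inter, Finset.prod_const]
      rw [hpow, ← Finset.prod_mul_distrib]
      refine Finset.prod_le_prod (fun r _ => (siteWeight_pos P K hκ s r).le) fun r _ => ?_
      split_ifs with hr
      · exact hR N P P' s r
      · rw [one_mul, siteWeight_congr P P' K κ s hr]
    have := Real.log_le_log (partitionFunction_pos N P K hκ) hle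
    rw [Real.log_mul (pow_pos hR0 _).ne' (partitionFunction_pos N P' K hκ).ne', Real.log_pow] at this
    linarith
  refine ⟨Real.log R, Real.log_nonneg h1R, fun N P P' => abs_sub_le_iff.2 ⟨?_, ?_⟩⟩
  · linarith [key N P P']
  · linarith [key N P' P]

lemma card_boundary_le (N : Fin 4 → ℕ) (hN : ∀ i, 0 < N i) :
    ((boundary N).card : ℝ) ≤ ((∏ i, N i : ℕ) : ℝ) * ∑ μ, 1 / (N μ : ℝ) := by
  have hface : ∀ μ, (Finset.univ.filter fun r : Site N => (r μ : ℕ) + 1 = N μ).card * N μ ≤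
      ∏ i, N i := by
    intro μ
    have h := Finset.card_le_card_of_injOn
      (s := (Finset.univ.filter fun r : Site N => (r μ : ℕ) + 1 = N μ) ×ˢ
        (Finset.univ : Finset (Fin (N μ)))) (t := (Finset.univ : Finset (Site N)))
      -- A face times its transverse edge injects into the box, since on the face the overwritten
      -- coordinate is already known.
      (fun q => Function.update q.1 μ q.2) (fun _ _ => Finset.mem_univ _) ?_
    · simpa [Finset.card_product, Fintype.card_pi] using h
    · rintro ⟨r, a⟩ hr ⟨r', a'⟩ hr' heq
      simp only [Finset.coe_product, Set.mem_prod, Finset.mem_coe, Finset.mem_filter,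
        Finset.mem_univ, true_and, and_true] at hr hr'
      have h1 : ∀ i, Function.update r μ a i = Function.update r' μ a' i := congrFun heq
      refine Prod.ext (funext fun i => ?_) (by simpa using h1 μ)
      by_cases hi : i = μ
      · subst hi
        exact Fin.ext (by simp only; omega)
      · simpa [hi] using h1 i
  have hsub : boundary N ⊆ Finset.univ.biUnion fun μ =>
      Finset.univ.filter fun r : Site N => (r μ : ℕ) + 1 = N μ := by
    intro r hr
    simpa [boundary] using hr
  calc ((boundary N).card : ℝ)
      ≤ ((∑ μ, (Finset.univ.filter fun r : Site N => (r μ : ℕ) + 1 = N μ).card : ℕ) : ℝ) :=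
        Nat.cast_le.2 ((Finset.card_le_card hsub).trans Finset.card_biUnion_le)
    _ ≤ ∑ μ, ((∏ i, N i : ℕ) : ℝ) * (1 / (N μ : ℝ)) := by
        rw [Nat.cast_sum]
        refine Finset.sum_le_sum fun μ _ => ?_
        have h0 : (0 : ℝ) < N μ := Nat.cast_pos.2 (hN μ)
        rw [mul_one_div, le_div_iff₀ h0]
        exact_mod_cast hface μ
    _ = _ := by rw [Finset.mul_sum]

/-- Self-duality of the periodic free energy per site, given exact self-duality for the self-dual
boundary conditions. -/
lemma tendsto_periodic_free_energy {K κ : ℝ} (hK : 0 < K) (hκ : 0 < κ)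
    (hdual : ∀ N : Fin 4 → ℕ, (∀ i, 0 < N i) → Z_sdG p N K κ = Z_sdG p N κ K) :
    Filter.Tendsto (fun N : Fin 4 → ℕ =>
        (Real.log (Z_sdG_periodic p N K κ) - Real.log (Z_sdG_periodic p N κ K)) /
          ((∏ i, N i : ℕ) : ℝ))
      Filter.atTop (nhds 0) := by
  obtain ⟨C₁, hC₁, h₁⟩ := exists_abs_log_sub_le p K hκ
  obtain ⟨C₂, hC₂, h₂⟩ := exists_abs_log_sub_le p κ hK
  have hlim : Filter.Tendsto (fun N : Fin 4 → ℕ => (C₁ + C₂) * ∑ μ, 1 / (N μ : ℝ))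
      Filter.atTop (nhds 0) := by
    have h : ∀ μ : Fin 4, Filter.Tendsto (fun N : Fin 4 → ℕ => 1 / (N μ : ℝ))
        Filter.atTop (nhds 0) := fun μ => tendsto_one_div_atTop_nhds_zero_nat.comp
      (Filter.tendsto_atTop_atTop.2 fun b => ⟨fun _ => b, fun a ha => ha μ⟩)
    simpa using (tendsto_finsetSum Finset.univ fun μ _ => h μ).const_mul (C₁ + C₂)
  refine squeeze_zero_norm' ?_ hlim
  filter_upwards [Filter.eventually_ge_atTop (fun _ : Fin 4 => 1)] with N hN
  have hN' : ∀ i, 0 < N i := fun i => hN i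
  have hprod : (0 : ℝ) < ((∏ i, N i : ℕ) : ℝ) :=
    Nat.cast_pos.2 (Finset.prod_pos fun i _ => hN' i)
  rw [Real.norm_eq_abs, abs_div, abs_of_pos hprod, div_le_iff₀ hprod]
  -- Each periodic free energy is compared with the self-dual one at the same couplings; the two
  -- self-dual ones coincide by `hdual`.
  have e₁ := abs_le.1 (h₁ N Finset.univ {3})
  have e₂ := abs_le.1 (h₂ N Finset.univ {3})
  have e₃ : partitionFunction p N {3} K κ = partitionFunction p N {3} κ K := hdual N hN'
  rw [e₃] at e₁
  calc |Real.log (Z_sdG_periodic p N K κ) - Real.log (Z_sdG_periodic p N κ K)|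
      ≤ (C₁ + C₂) * (boundary N).card := by
        rw [Z_sdG_periodic, Z_sdG_periodic, abs_le, add_mul]
        constructor <;> linarith [e₁.1, e₁.2, e₂.1, e₂.2]
    _ ≤ (C₁ + C₂) * (((∏ i, N i : ℕ) : ℝ) * ∑ μ, 1 / (N μ : ℝ)) :=
        mul_le_mul_of_nonneg_left (card_boundary_le N hN') (by positivity)
    _ = _ := by ring

end Boundary

/-- Both couplings must be positive, because each in turn defines the electric weight, whose
logarithm is taken. -/
lemma Z_sdG_swap (p : ℕ) [NeZero p] {N : Fin 4 → ℕ} (hN : 0 < N 3) {K κ : ℝ} (hK : 0 < K)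
    (hκ : 0 < κ) : Z_sdG p N K κ = Z_sdG p N κ K := by
  have h : ((Z_sdG p N K κ : ℝ) : ℂ) = (Z_sdG p N κ K : ℝ) := by
    rw [Z_sdG_eq_trace hN K hκ, Z_sdG_eq_trace hN κ hK, trace_transferMatrix_pow_swap]
  exact_mod_cast h

end ZpGauge

end

theorem mainTheorem7 (p : ℕ) [NeZero p] (K κ : ℝ) (hK : 0 < K) (hκ : 0 < κ) :
    -- the electric Boltzmann weight is well defined and has the stated cosine series
    ((∀ m : ℕ, 0 < ZpGauge.dualWeight p κ m) ∧
      NormedSpace.exp (((κ / 2 : ℝ) : ℂ) • (ZpGauge.weylV p + (ZpGauge.weylV p)ᴴ)) =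
        ∑ m ∈ Finset.range p,
          ((Real.exp (ZpGauge.logDualWeight p κ m) : ℝ) : ℂ) • ZpGauge.weylV p ^ m ∧
      ∀ l : ℕ, ZpGauge.logDualWeight p κ l =
        ∑ m ∈ Finset.range p,
          ZpGauge.epsilonCoeff p κ m * Real.cos (l * ZpGauge.angle p m)) ∧
    -- quantum self-duality on gauge-invariant states
    (∀ L : Fin 3 → ℕ, (∀ i, 0 < L i) →
      ∃ 𝒰 : Matrix (ZpGauge.Conf p L) (ZpGauge.Conf p L) ℂ,
        𝒰ᴴ * 𝒰 = ZpGauge.projGI p L ∧ 𝒰 * 𝒰ᴴ = ZpGauge.projGI p L ∧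
        (∀ (r : ZpGauge.Site L) (μ : Fin 3),
          𝒰 * ZpGauge.opV r μ = ZpGauge.opB (ZpGauge.reflect r) μ * 𝒰 ∧
          𝒰 * ZpGauge.opB r μ = ZpGauge.opV (ZpGauge.reflect r) μ * 𝒰) ∧
        ∀ lam : ℝ, lam ≠ 0 → 𝒰 * ZpGauge.hamiltonian p L lam =
          (lam : ℂ) • (ZpGauge.hamiltonian p L lam⁻¹ * 𝒰)) ∧
    (∀ N : Fin 4 → ℕ, (∀ i, 0 < N i) →
      -- the model is the one with transfer matrix `T_sdG`
      ((ZpGauge.Z_sdG p N K κ : ℝ) : ℂ) = (p : ℂ) ^ (∏ i, N i) *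
        Matrix.trace (ZpGauge.transferMatrix p (fun i : Fin 3 => N i.castSucc) K κ ^ N 3 *
          ZpGauge.projGI p (fun i : Fin 3 => N i.castSucc)) ∧
      -- exact self-duality
      ZpGauge.Z_sdG p N K κ = ZpGauge.Z_sdG p N κ K) ∧
    -- with periodic boundary conditions: self-duality of the free energy per site
    Filter.Tendsto (fun N : Fin 4 → ℕ =>
        (Real.log (ZpGauge.Z_sdG_periodic p N K κ) - Real.log (ZpGauge.Z_sdG_periodic p N κ K)) /
          ((∏ i, N i : ℕ) : ℝ))
      Filter.atTop (nhds 0) := by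
  refine ⟨⟨ZpGauge.dualWeight_pos hκ, ZpGauge.exp_weylV hκ, ZpGauge.logDualWeight_eq_sum κ⟩,
    fun L _ => ⟨ZpGauge.dualityOp p L, ?_, ?_, fun r μ => ⟨ZpGauge.dualityOp_mul_opV r μ,
      ZpGauge.dualityOp_mul_opB r μ⟩, fun lam hlam => ZpGauge.dualityOp_mul_hamiltonian hlam⟩,
    fun N hN => ⟨ZpGauge.Z_sdG_eq_trace (hN 3) K hκ, ZpGauge.Z_sdG_swap p (hN 3) hK hκ⟩,
    ZpGauge.tendsto_periodic_free_energy hK hκ fun N hN => ZpGauge.Z_sdG_swap p (hN 3) hK hκ⟩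
  · rw [ZpGauge.conjTranspose_dualityOp, ZpGauge.dualityOp_mul_self]
  · rw [ZpGauge.conjTranspose_dualityOp, ZpGauge.dualityOp_mul_self]
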